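/- Let $G=(\mathcal V,\mathcal E)$ be a finite connected simple non-bipartite graph, and let $\mu$ be a probability measure on $\mathcal V$ with $\mu(v)>0$ for every $v\in\mathcal V$. For $U\subset\mathcal V$ let $\mathcal E(U)$ be the set of nodes that have a neighbour in $U$; an independent set is a non-empty subset of $\mathcal V$ that contains no two neighbours. Let $\mathbb W$ be the set of finite words over $\mathcal V$ (including the empty word) in which no two letters are neighbours. For $w\in\mathbb W$ and $v\in\mathcal V$ let $w\odot v$ be the word $wv$ if no letter of $w$ is a neighbour of $v$, and otherwise the word obtained from $w$ by deleting its first letter that is a neighbour of $v$ (policy First Come, First Matched, FCFM). Let $V_0,V_1,\dots$ be i.i.d. with law $\mu$, and for $w\in\mathbb W$ let $W_0=w$, $W_{n+1}=W_n\odot V_n$ ($n\ge 0$); this Markov chain on $\mathbb W$ is the natural (queue-detail) chain of the model $(G,\mu,\mathrm{FCFM})$. The model $(G,\mu,\mathrm{FCFM})$ is stable, i.e. the chain $(W_n)$ is positive recurrent (from each state $w \in \mathbb W$, the mean return time to $w$ is finite), if and only if $$\mu(\mathcal I)<\mu(\mathcal E(\mathcal I))\quad\text{for every independent set }\mathcal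 I\text{ of }G.$$ In that case, the chain $(W_n)$ has exactly one stationary probability on $\mathbb W$, and it is given by $$\Pi_W(w)=\alpha\prod_{\ell=1}^q\frac{\mu(w_\ell)}{\mu\bigl(\mathcal E(\{w_1,\dots,w_\ell\})\bigr)}\qquad\text{for }w=w_1\cdots w_q\in\mathbb W.$$ Here $\alpha$ is the normalizing constant of the following measure $\Pi_B$. Let $\tilde{\mathcal V}=\{\tilde a: a\in\mathcal V\}$ be a disjoint copy of $\mathcal V$. Given finitely many arrivals in an initially empty system run under FCFM, write the items in their order of arrival, replacing each unmatched item by its class $a$ and each matched item by $\tilde a$, where $a$ is the class of the item it is matched with, and delete all that precedes the oldest unmatched item (the result is the empty word if all the items are matched). Let $\mathrm{adm}_B$ be the set of all the words over $\mathcal V\cup\tilde{\mathcal V}$ that can be so obtained from some finite sequence of arrivals. Then $\Pi_B(\mathbf w)$, for $\mathbf w\in\mathrm{adm}_B$, is the product of $\mu(a)$ over all letters $a$ and $\tilde a$ of $\mathbf w$, counted with multiplicity, and $\alpha=\bigl(\sum_{\mathbf w\in\mathrm{adm}_B}\Pi_B(\mathbf w)\bigr)^{-1}$. -/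

import Mathlib

open MeasureTheory ProbabilityTheory
open scoped ENNReal

namespace Matching

section Defs

variable {V : Type*} (G : SimpleGraph V)

/-- `nbhd G U` is `ℰ(U)`, the set of the nodes that have a neighbour in `U`. -/
def nbhd (U : Set V) : Set V := {v | ∃ u ∈ U, G.Adj u v}

/-- The state space `𝕎` of the queue detail: the words (oldest item first) in which no two
letters are compatible. -/
def QueueDetail : Type _ := {w : List V // ∀ i ∈ w, ∀ j ∈ w, ¬ G.Adj i j}

section FCFM

variable [DecidableRel G.Adj]

/-- The `FCFM` action of an arrival of class `v` on a word `w`: if no letter of `w` is compatible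
with `v`, then `v` is put at the end of the queue; otherwise the first (that is, oldest) letter
compatible with `v` is deleted, and `v` is not stored. -/
def fcfmWord (w : List V) (v : V) : List V :=
  if ∀ u ∈ w, ¬ G.Adj v u then w ++ [v]
  else w.eraseIdx (w.findIdx fun u => decide (G.Adj v u))

theorem fcfmWord_admissible (w : List V) (hw : ∀ i ∈ w, ∀ j ∈ w, ¬ G.Adj i j) (v : V) :
    ∀ i ∈ fcfmWord G w v, ∀ j ∈ fcfmWord G w v, ¬ G.Adj i j := by
  unfold fcfmWord
  split_ifs with h
  · intro i hi j hj
    rw [List.mem_append, List.mem_singleton] at hi hj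
    rcases hi with hi | rfl <;> rcases hj with hj | rfl
    · exact hw i hi j hj
    · exact fun hadj => h i hi hadj.symm
    · exact h j hj
    · exact G.loopless.irrefl _
  · intro i hi j hj
    exact hw i (List.mem_of_mem_eraseIdx hi) j (List.mem_of_mem_eraseIdx hj)

/-- The map `w ⊙ v` from `𝕎 × 𝒱` to `𝕎` of the policy `FCFM`. -/
def fcfm (w : QueueDetail G) (v : V) : QueueDetail G :=
  ⟨fcfmWord G w.1 v, fcfmWord_admissible G w.1 w.2 v⟩

/-- The natural chain `(W_n)` driven by the arrivals `A` and started from `w`: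
`W_0 = w` and `W_{n+1} = W_n ⊙ A_n`. -/
def naturalChain {Ω : Type*} (A : ℕ → Ω → V) (w : QueueDetail G) : ℕ → Ω → QueueDetail G
  | 0, _ => w
  | n + 1, ω => fcfm G (naturalChain A w n ω) (A n ω)

/-- The first return time `inf {n ≥ 1 : W_n = w}` to `w` of the chain started from `w`
(it is `∞` if the chain never returns). -/
noncomputable def returnTime {Ω : Type*} (A : ℕ → Ω → V) (w : QueueDetail G) (ω : Ω) : ℝ≥0∞ :=
  ⨅ (n : ℕ) (_ : 1 ≤ n ∧ naturalChain G A w n ω = w), (n : ℝ≥0∞)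

/-- Stability: the natural chain is positive recurrent, i.e. the mean return time to each state
is finite. -/
def IsStable {Ω : Type*} [MeasurableSpace Ω] (P : Measure Ω) (A : ℕ → Ω → V) : Prop :=
  ∀ w : QueueDetail G, ∫⁻ ω, returnTime G A w ω ∂P < ∞

/-- The probability law `π` on `𝕎` is stationary for the natural chain with i.i.d. arrivals of
law `μ`: the transition probability from `w` to `w'` is `μ {v | w ⊙ v = w'}`. -/
def IsStationary [MeasurableSpace V] (μ : Measure V) (π : PMF (QueueDetail G)) : Prop :=
  ∀ w' : QueueDetail G, π w' = ∑' w : QueueDetail G, π w * μ {v | fcfm G w v = w'}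

/-- One step of the detailed history of the system. A history lists all the items that have
arrived, in order of arrival: `Sum.inl a` is an unmatched item of class `a`, and `Sum.inr a` is
the copy of `a`, written at the place of an item that has been matched with an item of
class `a`. -/
def historyStep (h : List (V ⊕ V)) (v : V) : List (V ⊕ V) :=
  let k := h.findIdx (Sum.elim (fun u => decide (G.Adj v u)) fun _ => false)
  match h[k]? with
  | some (Sum.inl u) => h.set k (Sum.inr v) ++ [Sum.inr u]
  | _ => h ++ [Sum.inl v]

/-- The value of the backwards detailed chain, started from the empty word, after the arrivals
`z`: the history from the oldest unmatched item on (empty if all items are matched). -/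
def backwardState (z : List V) : List (V ⊕ V) :=
  (z.foldl (historyStep G) []).dropWhile Sum.isRight

/-- The set of the states that the backwards detailed chain can reach. -/
def admB : Set (List (V ⊕ V)) := Set.range (backwardState G)

end FCFM

section Measure

variable [MeasurableSpace V] (μ : Measure V)

/-- The condition `μ(I) < μ(ℰ(I))` for each independent (non-empty) set `I`. -/
def NCond : Prop :=
  ∀ I : Set V, I.Nonempty → G.IsIndepSet I → μ I < μ (nbhd G I)

/-- The measure `Π_B` of a detailed word: the product of the masses of the classes of its
letters, a letter and its copy having the same mass. -/
noncomputable def PiB (b : List (V ⊕ V)) : ℝ≥0∞ :=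
  (b.map fun x => μ {Sum.elim id id x}).prod

/-- The normalizing constant of `Π_B`, as a measure on the reachable detailed words. -/
noncomputable def alpha [DecidableRel G.Adj] : ℝ≥0∞ := (∑' b : admB G, PiB μ b.1)⁻¹

/-- `∏_{ℓ=1}^q μ(w_ℓ) / μ(ℰ({w_1, …, w_ℓ}))` for a word `w = w_1 … w_q`. -/
noncomputable def productForm (w : List V) : ℝ≥0∞ :=
  ∏ l : Fin w.length, μ {w.get l} / μ (nbhd G {u | ∃ k ≤ l, w.get k = u})

end Measure

end Defs

end Matching

/-!
For a word `w`, let `ℰ(w)` be the set of the nodes that have a neighbour among the letters of `w`.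

**Invariance.** A word `y` is entered either by storing its last letter, which carries the mass
`p(y) μ(ℰ(y))` of the product form `p`, or by deleting a letter `u` that was inserted at some
place `i` of `y`. The total over `i` of the second kind is `p(y) μ(u)` if `u ∉ ℰ(y)`
(`sum_productForm_insert`, an induction on the last letter of `y`), hence `p(y) μ(ℰ(y)ᶜ)` in all,
and `p` is invariant (`tsum_productForm_mul`).

**Normalization.** A detailed word is reachable if and only if it does not begin with a copy and
no unmatched letter `u` is followed by a letter or a copy of a class adjacent to `u`
(`mem_admB_iff`). So the reachable words whose unmatched letters are `w₁, …, w_q` are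
`w₁ z₁ ⋯ w_q z_q`, where `z_ℓ` is any word of copies of the nodes outside `ℰ(w₁ ⋯ w_ℓ)`; geometric
series turn their total mass into `∏ μ(w_ℓ) / μ(ℰ(w₁ ⋯ w_ℓ)) = p(w)` (`fiberMass_eq`). The sum
over all the reachable words is finite: as long as the set `I` of the unmatched classes does not
grow, each new letter multiplies the mass by `μ(ℰ(I)ᶜ) + μ(I)`, which is less than `1` by the
condition `NCond`, and `I` can grow only finitely often (`exists_truncMass_le`).

**Positive recurrence.** If `u_n(x)` is the probability to avoid the state `w` at the times
`1, …, n` from `x`, the mean return time to `w` is `∑ u_n(w)` (`lintegral_returnTime`). For a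
stationary `π`, `∑ π(x) u_n(x)` decreases by `π(w) u_n(w)` when `n` increases by one, so that
`π(w) ∑ u_n(w) ≤ 1` (`mul_tsum_iterate_tabooOp_le`).

**Necessity.** If `μ(ℰ(I)) ≤ μ(I)` for an independent set `I`, put `s = 1_I - 1_{ℰ(I)}`. Then
`s(u) + s(v) ≤ 0` on each edge, with strict inequality on some edge as the graph is not bipartite,
so the sum `M` of `s` over the letters is a submartingale. Stopped at the return to the
empty word, where `M` vanishes, it has a mean bounded below by some `c > 0`; as `M` is at most `n`
after `n` arrivals, `n u_n(∅) ≥ c` for `n ≥ 2` and the harmonic series shows that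
`∑ u_n(∅)` diverges (`not_summable_iterate_tabooOp`).

**Uniqueness.** The chain is irreducible, and the pointwise minimum of two stationary probabilities
is stationary, so the positive part of their difference vanishes everywhere or nowhere
(`stationary_unique`).
-/

open scoped NNReal

namespace Matching

/-! ### The reachable detailed words -/

section

variable {V : Type*} (G : SimpleGraph V)

/-- The letter `y` may stand after the letter `x` in a detailed word: if `x` is an unmatched item,
its class is not adjacent to the class written at `y`, be `y` unmatched or a copy. -/
def Compat (x y : V ⊕ V) : Prop := ∀ u, x = Sum.inl u → ¬ G.Adj u (Sum.elim id id y)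

theorem historyStep_of_forall_not_adj [DecidableRel G.Adj] {h : List (V ⊕ V)} {v : V}
    (hh : ∀ u, Sum.inl u ∈ h → ¬ G.Adj v u) : historyStep G h v = h ++ [Sum.inl v] := by
  have : h.findIdx (Sum.elim (fun u => decide (G.Adj v u)) fun _ => false) = h.length := by
    rw [List.findIdx_eq_length]
    rintro (u | u) hu
    · simpa using hh u hu
    · rfl
  simp [historyStep, this]

theorem historyStep_of_match [DecidableRel G.Adj] {h₁ h₂ : List (V ⊕ V)} {u v : V}
    (hh : ∀ x, Sum.inl x ∈ h₁ → ¬ G.Adj v x) (huv : G.Adj v u) :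
    historyStep G (h₁ ++ Sum.inl u :: h₂) v = h₁ ++ Sum.inr v :: (h₂ ++ [Sum.inr u]) := by
  have h1 : ∀ x ∈ h₁, (Sum.elim (fun u => decide (G.Adj v u)) fun _ => false) x = false := by
    rintro (x | x) hx
    · simpa using hh x hx
    · rfl
  have : (h₁ ++ Sum.inl u :: h₂).findIdx
      (Sum.elim (fun u => decide (G.Adj v u)) fun _ => false) = h₁.length := by
    rw [List.findIdx_append, List.findIdx_eq_length_of_false h1]
    simp [List.findIdx_cons, huv]
  simp [historyStep, this]

theorem exists_first_match {v : V} {h : List (V ⊕ V)} (hh : ∃ u, Sum.inl u ∈ h ∧ G.Adj v u) :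
    ∃ h₁ u h₂, h = h₁ ++ Sum.inl u :: h₂ ∧ G.Adj v u ∧ ∀ x, Sum.inl x ∈ h₁ → ¬ G.Adj v x := by
  induction h with
  | nil => simp at hh
  | cons y t ih =>
    by_cases hy : ∃ u, y = Sum.inl u ∧ G.Adj v u
    · obtain ⟨u, rfl, hu⟩ := hy
      exact ⟨[], u, t, rfl, hu, by simp⟩
    · obtain ⟨u, hu, huv⟩ := hh
      rcases List.mem_cons.1 hu with rfl | hu
      · exact absurd ⟨u, rfl, huv⟩ hy
      · obtain ⟨h₁, u, h₂, rfl, h2, h3⟩ := ih ⟨u, hu, huv⟩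
        refine ⟨y :: h₁, u, h₂, rfl, h2, fun x hx hvx => ?_⟩
        rcases List.mem_cons.1 hx with rfl | hx
        · exact hy ⟨x, rfl, hvx⟩
        · exact h3 x hx hvx

theorem pairwise_historyStep [DecidableRel G.Adj] {h : List (V ⊕ V)}
    (hh : h.Pairwise (Compat G)) (v : V) : (historyStep G h v).Pairwise (Compat G) := by
  by_cases hm : ∃ u, Sum.inl u ∈ h ∧ G.Adj v u
  · obtain ⟨h₁, u, h₂, rfl, huv, hx⟩ := exists_first_match G hm
    rw [historyStep_of_match G hx huv]
    simp only [List.pairwise_append, List.pairwise_cons, List.mem_cons, List.mem_append,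
      List.mem_nil_iff, or_false, List.Pairwise.nil] at hh ⊢
    obtain ⟨h1, ⟨h2, h3⟩, h4⟩ := hh
    refine ⟨h1, ⟨fun _ _ _ h => by simp at h, h3, by simp, ?_⟩, ?_⟩
    · rintro x hx₂ y rfl w rfl hadj
      exact h2 _ hx₂ u rfl hadj.symm
    · rintro x hx₁ y (rfl | hy | rfl) w rfl hadj
      · exact hx w hx₁ hadj.symm
      · exact h4 _ hx₁ _ (Or.inr hy) w rfl hadj
      · exact h4 _ hx₁ _ (Or.inl rfl) w rfl hadj
  · push Not at hm
    rw [historyStep_of_forall_not_adj G hm, List.pairwise_append]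
    refine ⟨hh, by simp, ?_⟩
    simp only [List.mem_singleton]
    rintro x hx y rfl w rfl hadj
    exact hm w hx hadj.symm

theorem exists_last_right {p : V → Prop} {b : List (V ⊕ V)} (hb : ∃ a, Sum.inr a ∈ b ∧ p a) :
    ∃ b₁ a b₂, b = b₁ ++ Sum.inr a :: b₂ ∧ p a ∧ ∀ x, Sum.inr x ∈ b₂ → ¬ p x := by
  induction b with
  | nil => simp at hb
  | cons y t ih =>
    by_cases ht : ∃ a, Sum.inr a ∈ t ∧ p a
    · obtain ⟨b₁, a, b₂, rfl, h2, h3⟩ := ih ht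
      exact ⟨y :: b₁, a, b₂, rfl, h2, h3⟩
    · obtain ⟨a, ha, hpa⟩ := hb
      push Not at ht
      rcases List.mem_cons.1 ha with rfl | ha
      · exact ⟨[], a, t, rfl, hpa, ht⟩
      · exact absurd hpa (ht a ha)

/-- Each pairwise compatible word is the end of a history whose earlier items are all matched. The
last arrival is undone: a final unmatched letter is removed; for a final copy of `u`, the item `u`
is put back at the last earlier copy of a neighbour of `u`, or in front of the word if there is
none. -/
theorem exists_history_eq_append [DecidableRel G.Adj] (hdeg : ∀ v, ∃ u, G.Adj v u)
    (b : List (V ⊕ V)) (hb : b.Pairwise (Compat G)) :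
    ∃ (z : List V) (c : List (V ⊕ V)), (∀ x ∈ c, x.isRight = true) ∧
      z.foldl (historyStep G) [] = c ++ b := by
  -- Each step back removes a letter or turns a copy into an unmatched letter.
  induction hn : b.length + b.countP Sum.isRight using Nat.strong_induction_on generalizing b with
  | _ n ih =>
  rcases List.eq_nil_or_concat' b with rfl | ⟨b', x, rfl⟩
  · exact ⟨[], [], by simp, rfl⟩
  have hb' : b'.Pairwise (Compat G) := (List.pairwise_append.1 hb).1
  have hx : ∀ y ∈ b', Compat G y x := fun y hy =>
    (List.pairwise_append.1 hb).2.2 y hy x (List.mem_singleton_self x)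
  have not_left {c : List (V ⊕ V)} (hc : ∀ x ∈ c, x.isRight = true) (u : V) :
      Sum.inl u ∉ c := fun h => by simpa using hc _ h
  rcases x with v | u
  · obtain ⟨z, c, hc, hz⟩ := ih _ (by simp [← hn]) b' hb' rfl
    refine ⟨z ++ [v], c, hc, ?_⟩
    rw [List.foldl_append, hz, List.foldl_cons, List.foldl_nil,
      historyStep_of_forall_not_adj, List.append_assoc]
    intro u hu hadj
    rcases List.mem_append.1 hu with hu | hu
    · exact not_left hc u hu
    · exact hx _ hu u rfl hadj.symm
  · by_cases hv : ∃ v, Sum.inr v ∈ b' ∧ G.Adj v u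
    · obtain ⟨b₁, v, b₂, rfl, hvu, hlast⟩ := exists_last_right hv
      have hp : (b₁ ++ Sum.inl u :: b₂).Pairwise (Compat G) := by
        rw [List.pairwise_append, List.pairwise_cons] at hb' ⊢
        refine ⟨hb'.1, ⟨?_, hb'.2.1.2⟩, ?_⟩
        · rintro (y | y) hy w hw hadj <;> obtain rfl := Sum.inl_injective hw
          · exact hx (Sum.inl y) (by simp [hy]) y rfl hadj.symm
          · exact hlast y hy hadj.symm
        · intro y hy y' hy'
          rcases List.mem_cons.1 hy' with rfl | hy'
          · exact hx y (by simp [hy])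
          · exact hb'.2.2 y hy y' (List.mem_cons_of_mem _ hy')
      obtain ⟨z, c, hc, hz⟩ := ih _ (by simp [← hn, List.countP_cons]; omega) _ hp rfl
      refine ⟨z ++ [v], c, hc, ?_⟩
      rw [List.foldl_append, hz, List.foldl_cons, List.foldl_nil, ← List.append_assoc,
        historyStep_of_match (h₁ := c ++ b₁) G ?_ hvu]
      · simp
      · intro y hy hadj
        rcases List.mem_append.1 hy with hy | hy
        · exact not_left hc y hy
        · exact (List.pairwise_append.1 hb').2.2 _ hy (Sum.inr v) (by simp) y rfl hadj.symm
    · push Not at hv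
      have hp : (Sum.inl u :: b').Pairwise (Compat G) := by
        refine List.pairwise_cons.2 ⟨?_, hb'⟩
        rintro (y | y) hy w hw hadj <;> obtain rfl := Sum.inl_injective hw
        · exact hx (Sum.inl y) hy y rfl hadj.symm
        · exact hv y hy hadj.symm
      obtain ⟨z, c, hc, hz⟩ := ih _ (by simp [← hn]) _ hp rfl
      obtain ⟨v, huv⟩ := hdeg u
      refine ⟨z ++ [v], c ++ [Sum.inr v], ?_, ?_⟩
      · intro x hx
        rcases List.mem_append.1 hx with hx | hx
        · exact hc x hx
        · simp [List.mem_singleton.1 hx]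
      · rw [List.foldl_append, hz, List.foldl_cons, List.foldl_nil,
          historyStep_of_match G (fun x hx => absurd hx (not_left hc x)) huv.symm]
        simp

/-- The explicit description of the words in `admB`: each letter is compatible with the earlier
ones in the sense of `Compat`, and the word does not begin with a copy. -/
def IsReachable (b : List (V ⊕ V)) : Prop :=
  b.Pairwise (Compat G) ∧ ∀ a, b.head? ≠ some (Sum.inr a)

theorem mem_admB_iff [DecidableRel G.Adj] (hdeg : ∀ v, ∃ u, G.Adj v u) (b : List (V ⊕ V)) :
    b ∈ admB G ↔ IsReachable G b := by
  rw [IsReachable]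
  constructor
  · rintro ⟨z, rfl⟩
    constructor
    · have : (z.foldl (historyStep G) []).Pairwise (Compat G) := by
        induction z using List.reverseRecOn with
        | nil => simp
        | append_singleton z v ih =>
          rw [List.foldl_append]
          exact pairwise_historyStep G ih v
      exact this.sublist (List.dropWhile_sublist _)
    · intro a ha
      have := List.head?_dropWhile_not Sum.isRight (z.foldl (historyStep G) [])
      unfold backwardState at ha
      rw [ha] at this
      simp at this
  · rintro ⟨hb, hhead⟩
    obtain ⟨z, c, hc, hz⟩ := exists_history_eq_append G hdeg b hb
    refine ⟨z, ?_⟩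
    rw [backwardState, hz, List.dropWhile_append_of_pos hc]
    rcases b with _ | ⟨x | a, b⟩
    · rfl
    · simp
    · exact absurd rfl (hhead a)

end

/-! ### Summing the detailed words over a given queue detail -/

section

/-- Split a sum over the lists according to the first letter. -/
theorem tsum_list {α : Type*} (f : List α → ℝ≥0∞) :
    ∑' l, f l = f [] + ∑' a, ∑' l, f (a :: l) := by
  let e : Unit ⊕ (α × List α) ≃ List α :=
    { toFun := Sum.elim (fun _ => []) fun x => x.1 :: x.2
      invFun := fun l => match l with
        | [] => Sum.inl ()
        | a :: l => Sum.inr (a, l)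
      left_inv := by rintro (_ | ⟨a, l⟩) <;> rfl
      right_inv := by rintro (_ | ⟨a, l⟩) <;> rfl }
  rw [← e.tsum_eq, Summable.tsum_sum ENNReal.summable ENNReal.summable, tsum_fintype,
    ← ENNReal.tsum_prod (f := fun a l => f (a :: l))]
  simp [e]

theorem tsum_list_prod {α : Type*} [Fintype α] (q : α → ℝ≥0∞) :
    ∑' c : List α, (c.map q).prod = (1 - ∑ a, q a)⁻¹ := by
  rw [← List.equivSigmaTuple.symm.tsum_eq, ENNReal.tsum_sigma', ← ENNReal.tsum_geometric]
  refine tsum_congr fun n => ?_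
  rw [tsum_fintype, Fintype.sum_pow]
  refine Finset.sum_congr rfl fun f _ => ?_
  simp [List.equivSigmaTuple, List.map_ofFn, List.prod_ofFn]

theorem measure_eq_sum {V : Type*} [Fintype V] [MeasurableSpace V] [MeasurableSingletonClass V]
    (μ : Measure V) (s : Set V) [DecidablePred (· ∈ s)] :
    μ s = ∑ v, if v ∈ s then μ {v} else 0 := by
  rw [← Finset.sum_filter, sum_measure_singleton]
  simp

variable {V : Type*} (G : SimpleGraph V)

@[simp] theorem nbhd_empty : nbhd G ∅ = ∅ := by simp [nbhd]

theorem nbhd_union (s t : Set V) : nbhd G (s ∪ t) = nbhd G s ∪ nbhd G t := by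
  ext v; simp [nbhd, or_and_right, exists_or]

theorem ofPred_mem_append_singleton (w : List V) (v : V) :
    {u | u ∈ w ++ [v]} = {u | u ∈ w} ∪ {v} := by ext; simp [or_comm]

theorem inl_mem_iff_mem_filterMap {b : List (V ⊕ V)} {u : V} :
    Sum.inl u ∈ b ↔ u ∈ b.filterMap Sum.getLeft? := by
  simp [List.mem_filterMap, Sum.getLeft?_eq_some_iff]

theorem exists_eq_append_of_filterMap {b : List (V ⊕ V)} {w : List V} {v : V}
    (h : b.filterMap Sum.getLeft? = w ++ [v]) :
    ∃ (b' : List (V ⊕ V)) (c : List V), b = b' ++ Sum.inl v :: c.map Sum.inr ∧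
      b'.filterMap Sum.getLeft? = w := by
  obtain ⟨b₁, b₂, rfl, h₁, h₂⟩ := List.filterMap_eq_append_iff.1 h
  obtain ⟨b₃, x, b₄, rfl, h₃, hx, h₄⟩ := List.filterMap_eq_cons_iff.1 h₂
  rw [Sum.getLeft?_eq_some_iff] at hx
  subst hx
  refine ⟨b₁ ++ b₃, b₄.filterMap Sum.getRight?, ?_, ?_⟩
  · rw [List.append_assoc]
    congr 3
    rw [List.filterMap_eq_nil_iff] at h₄
    clear h h₂
    induction b₄ with
    | nil => rfl
    | cons y t ih =>
      rcases y with y | y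
      · simpa using h₄ (Sum.inl y) (by simp)
      · simpa using ih fun a ha => h₄ a (List.mem_cons_of_mem _ ha)
  · rw [List.filterMap_append, h₁, List.filterMap_eq_nil_iff.2 h₃, List.append_nil]

theorem append_inl_map_inr_injective (v : V) :
    Function.Injective fun x : List (V ⊕ V) × List V => x.1 ++ Sum.inl v :: x.2.map Sum.inr := by
  rintro ⟨b, c⟩ ⟨b', c'⟩ h
  have key (b : List (V ⊕ V)) (c : List V) :
      ((b ++ Sum.inl v :: c.map Sum.inr).reverse).takeWhile Sum.isRight
        = (c.map Sum.inr).reverse := by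
    rw [List.reverse_append, List.reverse_cons, List.append_assoc,
      List.takeWhile_append_of_pos (by simp)]
    simp
  have hc : c = c' := by
    have h2 := key b c
    simp only at h
    rw [h, key] at h2
    exact (List.map_injective_iff.2 Sum.inr_injective (List.reverse_injective h2)).symm
  subst hc
  simpa using h

theorem isReachable_append_iff (b : List (V ⊕ V)) (v : V) (c : List V) :
    IsReachable G (b ++ Sum.inl v :: c.map Sum.inr) ↔
      (IsReachable G b ∧ ∀ u, u ∈ b.filterMap Sum.getLeft? → ¬ G.Adj u v) ∧
        ∀ a ∈ c, a ∉ nbhd G {u | u ∈ b.filterMap Sum.getLeft? ++ [v]} := by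
  have hhead : (∀ a, (b ++ Sum.inl v :: c.map Sum.inr).head? ≠ some (Sum.inr a)) ↔
      ∀ a, b.head? ≠ some (Sum.inr a) := by
    cases b <;> simp
  have hc : (c.map Sum.inr : List (V ⊕ V)).Pairwise (Compat G) := by
    rw [List.pairwise_map]
    exact List.pairwise_of_forall fun x y u hu => by simp at hu
  unfold IsReachable
  rw [hhead, List.pairwise_append, List.pairwise_cons]
  simp only [hc, and_true, List.mem_map, List.mem_cons, nbhd, ← inl_mem_iff_mem_filterMap,
    Set.mem_ofPred_eq, not_exists, not_and, List.mem_append, List.not_mem_nil, or_false]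
  constructor
  · rintro ⟨⟨hb, hv, hbc⟩, hh⟩
    refine ⟨⟨⟨hb, hh⟩, fun u hu => hbc _ hu _ (Or.inl rfl) u rfl⟩, ?_⟩
    rintro a ha u (hu | rfl)
    · exact hbc _ hu _ (Or.inr ⟨a, ha, rfl⟩) u rfl
    · exact hv _ ⟨a, ha, rfl⟩ u rfl
  · rintro ⟨⟨⟨hb, hh⟩, hv⟩, hc⟩
    refine ⟨⟨hb, ?_, ?_⟩, hh⟩
    · rintro _ ⟨a, ha, rfl⟩ u hu
      obtain rfl := Sum.inl_injective hu
      exact hc a ha _ (Or.inr rfl)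
    · rintro y hy _ (rfl | ⟨a, ha, rfl⟩) u rfl
      · exact hv u hy
      · exact hc a ha u (Or.inl hy)

open Classical in
theorem tsum_queueDetail (f : List V → ℝ≥0∞) :
    ∑' w : QueueDetail G, f w.1 =
      ∑' w : List V, if ∀ i ∈ w, ∀ j ∈ w, ¬ G.Adj i j then f w else 0 :=
  (tsum_subtype {w : List V | ∀ i ∈ w, ∀ j ∈ w, ¬ G.Adj i j} f).trans
    (tsum_congr fun w => by simp [Set.indicator_apply])

variable [MeasurableSpace V] (μ : Measure V)

theorem measure_nbhd_pos (hdeg : ∀ v, ∃ u, G.Adj v u) (hμ : ∀ v, 0 < μ {v}) {s : Set V}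
    (hs : s.Nonempty) : 0 < μ (nbhd G s) := by
  obtain ⟨v, hv⟩ := hs
  obtain ⟨u, hu⟩ := hdeg v
  exact (hμ u).trans_le (measure_mono (Set.singleton_subset_iff.2 ⟨v, hv, hu⟩))

theorem productForm_eq_prod_take (w : List V) :
    productForm G μ w =
      ∏ l : Fin w.length, μ {w[l]} / μ (nbhd G {u | u ∈ w.take (l + 1)}) := by
  refine Finset.prod_congr rfl fun l _ => ?_
  congr 3
  ext u
  simp only [List.get_eq_getElem, Set.mem_ofPred_eq, List.mem_take_iff_getElem]
  constructor
  · rintro ⟨k, hk, rfl⟩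
    exact ⟨k, by have := k.2; have : (k : ℕ) ≤ l := hk; omega, rfl⟩
  · rintro ⟨k, hk, rfl⟩
    exact ⟨⟨k, by omega⟩, Fin.le_def.2 (by simp; omega), rfl⟩

@[simp] theorem productForm_nil : productForm G μ [] = 1 := by simp [productForm]

theorem productForm_append_singleton (w : List V) (v : V) :
    productForm G μ (w ++ [v]) =
      productForm G μ w * (μ {v} / μ (nbhd G {u | u ∈ w ++ [v]})) := by
  have hlen : w.length + 1 = (w ++ [v]).length := by simp
  rw [productForm_eq_prod_take, productForm_eq_prod_take, ← (finCongr hlen).prod_comp,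
    Fin.prod_univ_castSucc]
  congr 1
  · refine Finset.prod_congr rfl fun l _ => ?_
    have := l.2
    simp [List.take_append_of_le_length (Nat.succ_le_of_lt l.2)]
  · simp [List.take_of_length_le]

@[simp] theorem PiB_nil : PiB μ ([] : List (V ⊕ V)) = 1 := rfl

theorem PiB_cons (x : V ⊕ V) (b : List (V ⊕ V)) :
    PiB μ (x :: b) = μ {Sum.elim id id x} * PiB μ b := by simp [PiB]

theorem PiB_append (b c : List (V ⊕ V)) : PiB μ (b ++ c) = PiB μ b * PiB μ c := by
  simp [PiB]

open Classical in
/-- The total mass of the reachable detailed words whose unmatched letters form the word `w`. -/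
noncomputable def fiberMass (w : List V) : ℝ≥0∞ :=
  ∑' b : List (V ⊕ V),
    if IsReachable G b ∧ b.filterMap Sum.getLeft? = w then PiB μ b else 0

open Classical in
theorem tsum_PiB_map_inr [Fintype V] [MeasurableSingletonClass V] [IsProbabilityMeasure μ]
    (s : Set V) :
    ∑' c : List V, (if ∀ a ∈ c, a ∉ s then PiB μ (c.map Sum.inr) else 0) = (μ s)⁻¹ := by
  have h (c : List V) : (if ∀ a ∈ c, a ∉ s then PiB μ (c.map Sum.inr) else 0)
      = (c.map fun a => if a ∈ sᶜ then μ {a} else 0).prod := by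
    induction c with
    | nil => simp
    | cons a c ih =>
      rw [List.map_cons (l := c), List.map_cons, List.prod_cons, ← ih, PiB_cons]
      by_cases ha : a ∈ s <;> simp [ha]
  rw [tsum_congr h, tsum_list_prod, ← measure_eq_sum,
    ← prob_compl_eq_one_sub (Set.toFinite _).measurableSet, compl_compl]

open Classical in
theorem fiberMass_eq [Fintype V] [MeasurableSingletonClass V] [IsProbabilityMeasure μ]
    (w : List V) :
    fiberMass G μ w = if ∀ i ∈ w, ∀ j ∈ w, ¬ G.Adj i j then productForm G μ w else 0 := by
  induction w using List.reverseRecOn with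
  | nil =>
    -- A word without unmatched letters consists of copies, so it is empty.
    rw [fiberMass, tsum_eq_single []]
    · simp [IsReachable]
    · intro b hb
      refine if_neg fun h => ?_
      rcases b with _ | ⟨x | x, b⟩
      · exact hb rfl
      · simp at h
      · exact h.1.2 x rfl
  | append_singleton w v ih =>
    have hterm (x : List (V ⊕ V) × List V) :
        (if IsReachable G (x.1 ++ Sum.inl v :: x.2.map Sum.inr) ∧
          (x.1 ++ Sum.inl v :: x.2.map Sum.inr).filterMap Sum.getLeft? = w ++ [v]
          then PiB μ (x.1 ++ Sum.inl v :: x.2.map Sum.inr) else 0) =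
        (if ∀ u ∈ w, ¬ G.Adj u v then 1 else 0) *
        ((if IsReachable G x.1 ∧ x.1.filterMap Sum.getLeft? = w then PiB μ x.1 else 0) *
          (μ {v} * if ∀ a ∈ x.2, a ∉ nbhd G {u | u ∈ w ++ [v]} then
            PiB μ (x.2.map Sum.inr) else 0)) := by
      have hf : (x.1 ++ Sum.inl v :: x.2.map Sum.inr).filterMap Sum.getLeft? =
          x.1.filterMap Sum.getLeft? ++ [v] := by
        simp
      rw [hf, isReachable_append_iff, PiB_append, PiB_cons]
      by_cases hw : x.1.filterMap Sum.getLeft? = w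
      · rw [hw]
        by_cases h : (IsReachable G x.1 ∧ ∀ u ∈ w, ¬ G.Adj u v) ∧
            ∀ a ∈ x.2, a ∉ nbhd G {u | u ∈ w ++ [v]}
        · rw [if_pos ⟨h, rfl⟩, if_pos h.1.2, if_pos ⟨h.1.1, rfl⟩, if_pos h.2, one_mul]
          rfl
        · rw [if_neg fun h' => h h'.1]
          refine (of_not_not fun hne => h ?_ : _ = _).symm
          simp only [← ne_eq, mul_ne_zero_iff, ite_ne_right_iff] at hne
          exact ⟨⟨hne.2.1.1.1, hne.1.1⟩, hne.2.2.2.1⟩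
      · simp [hw]
    rw [fiberMass, ← (append_inl_map_inr_injective v).tsum_eq, tsum_congr hterm,
      ENNReal.tsum_mul_left, ENNReal.tsum_prod']
    · simp_rw [ENNReal.tsum_mul_left, ENNReal.tsum_mul_right]
      rw [tsum_PiB_map_inr, ← fiberMass, ih, productForm_append_singleton]
      have hadm : (∀ i ∈ w ++ [v], ∀ j ∈ w ++ [v], ¬ G.Adj i j) ↔
          (∀ u ∈ w, ¬ G.Adj u v) ∧ ∀ i ∈ w, ∀ j ∈ w, ¬ G.Adj i j := by
        simp only [List.mem_append, List.mem_singleton]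
        constructor
        · exact fun h => ⟨fun u hu => h u (Or.inl hu) v (Or.inr rfl),
            fun i hi j hj => h i (Or.inl hi) j (Or.inl hj)⟩
        · rintro ⟨h1, h2⟩ i (hi | rfl) j (hj | rfl)
          · exact h2 i hi j hj
          · exact h1 i hi
          · exact fun h => h1 j hj h.symm
          · exact G.irrefl
      simp only [hadm]
      rw [ite_and]
      split_ifs <;> simp [div_eq_mul_inv]
    · intro b hb
      have hb' := (ite_ne_right_iff.1 hb).1
      obtain ⟨b', c, rfl, -⟩ := exists_eq_append_of_filterMap hb'.2
      exact ⟨(b', c), rfl⟩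

theorem tsum_admB_eq [Fintype V] [MeasurableSingletonClass V] [IsProbabilityMeasure μ]
    [DecidableRel G.Adj] (hdeg : ∀ v, ∃ u, G.Adj v u) :
    ∑' b : admB G, PiB μ b.1 = ∑' w : QueueDetail G, productForm G μ w.1 := by
  classical
  rw [tsum_subtype (admB G) (PiB μ)]
  trans ∑' w : List V, fiberMass G μ w
  · unfold fiberMass
    rw [ENNReal.tsum_comm]
    refine tsum_congr fun b => ?_
    rw [tsum_eq_single (b.filterMap Sum.getLeft?) fun w hw => if_neg fun h => hw h.2.symm]
    simp [Set.indicator_apply, mem_admB_iff G hdeg, IsReachable]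
  · rw [tsum_queueDetail]
    exact tsum_congr fun w => by rw [fiberMass_eq]; congr

end

/-! ### Finiteness of the normalizing constant -/

section

variable {V : Type*} (G : SimpleGraph V) [MeasurableSpace V] (μ : Measure V)

open Classical in
/-- The mass of `b` as a continuation of a detailed word whose unmatched letters have the classes
`I`; it is `0` if `b` cannot follow such a word. -/
noncomputable def contWeight (I : Set V) (b : List (V ⊕ V)) : ℝ≥0∞ :=
  if b.Pairwise (Compat G) ∧ ∀ x ∈ b, Sum.elim id id x ∉ nbhd G I then PiB μ b else 0

@[simp] theorem contWeight_nil (I : Set V) : contWeight G μ I [] = 1 := by simp [contWeight]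

open Classical in
theorem contWeight_inr_cons (I : Set V) (a : V) (b : List (V ⊕ V)) :
    contWeight G μ I (Sum.inr a :: b) =
      (if a ∈ (nbhd G I)ᶜ then μ {a} else 0) * contWeight G μ I b := by
  have h (y : V ⊕ V) : Compat G (Sum.inr a) y := fun u hu => by simp at hu
  unfold contWeight
  simp only [List.pairwise_cons, List.forall_mem_cons, PiB_cons, Set.mem_compl_iff, h,
    Sum.elim_inr, id_eq, implies_true, true_and]
  by_cases ha : a ∈ nbhd G I <;> simp [ha]

open Classical in
theorem contWeight_inl_cons (I : Set V) (v : V) (b : List (V ⊕ V)) :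
    contWeight G μ I (Sum.inl v :: b) =
      (if v ∈ (nbhd G I)ᶜ then μ {v} else 0) * contWeight G μ (insert v I) b := by
  have h : ((∀ y ∈ b, Compat G (Sum.inl v) y) ∧ b.Pairwise (Compat G)) ∧
      (∀ x ∈ b, Sum.elim id id x ∉ nbhd G I) ↔
      b.Pairwise (Compat G) ∧ ∀ x ∈ b, Sum.elim id id x ∉ nbhd G (insert v I) := by
    simp only [Compat, Sum.inl.injEq, nbhd, Set.mem_insert_iff, Set.mem_ofPred_eq, not_exists,
      not_and, forall_eq_or_imp, forall_eq', forall_and]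
    tauto
  unfold contWeight
  simp only [← h, List.pairwise_cons, List.forall_mem_cons, PiB_cons, Set.mem_compl_iff,
    Sum.elim_inl, id_eq]
  by_cases hv : v ∈ nbhd G I <;> simp [hv]

/-- The total mass `contWeight` of the continuations of length less than `N`. -/
noncomputable def truncMass (N : ℕ) (I : Set V) : ℝ≥0∞ :=
  ∑' b : List (V ⊕ V), if b.length < N then contWeight G μ I b else 0

open Classical in
theorem truncMass_succ [Fintype V] [MeasurableSingletonClass V] (N : ℕ) (I : Set V) :
    truncMass G μ (N + 1) I = 1 + (μ (nbhd G I)ᶜ * truncMass G μ N I +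
      ∑ v, (if v ∈ (nbhd G I)ᶜ then μ {v} else 0) * truncMass G μ N (insert v I)) := by
  rw [truncMass, tsum_list, tsum_fintype, Fintype.sum_sum_type, add_comm (∑ _, _),
    measure_eq_sum μ (nbhd G I)ᶜ, Finset.sum_mul]
  simp only [contWeight_inr_cons, contWeight_inl_cons, List.length_cons, add_lt_add_iff_right,
    ← mul_ite_zero, ENNReal.tsum_mul_left]
  simp [truncMass]

/-- The masses of the truncated continuations are bounded, by induction on the number of classes
outside `I`. Truncation keeps the quantities finite in the recursion of `truncMass_succ`. -/
theorem exists_truncMass_le [Fintype V] [MeasurableSingletonClass V] [IsProbabilityMeasure μ]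
    (hN : NCond G μ) (I : Set V) (hI : I.Nonempty) (hind : G.IsIndepSet I) :
    ∃ C < ∞, ∀ N, truncMass G μ N I ≤ C := by
  classical
  induction hn : Iᶜ.ncard using Nat.strong_induction_on generalizing I with
  | _ n ih =>
  have hext (v : V) (hv : v ∉ nbhd G I ∪ I) :
      ∃ C < ∞, ∀ N, truncMass G μ N (insert v I) ≤ C := by
    rw [Set.mem_union, not_or] at hv
    refine ih _ ?_ (insert v I) (Set.insert_nonempty _ _) ?_ rfl
    · rw [← hn]
      refine Set.ncard_lt_ncard ?_ (Set.toFinite _)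
      exact compl_lt_compl_iff_lt.2 (Set.ssubset_insert hv.2)
    · refine Set.Pairwise.insert hind fun u hu _ => ⟨fun h => ?_, fun h => ?_⟩
      · exact hv.1 ⟨u, hu, h.symm⟩
      · exact hv.1 ⟨u, hu, h⟩
  choose! C hC hCle using hext
  -- The factor of a letter that leaves `I` unchanged: a copy, or a class that is already in `I`.
  set r := μ (nbhd G I)ᶜ + μ I
  have hr : r < 1 := by
    rw [← prob_add_prob_compl (μ := μ) (Set.toFinite (nbhd G I)).measurableSet, add_comm (μ _)]
    exact ENNReal.add_lt_add_left (measure_ne_top _ _) (hN I hI hind)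
  set R := ∑ v, if v ∈ (nbhd G I ∪ I)ᶜ then μ {v} * C v else 0
  have hR : R < ∞ := by
    refine ENNReal.sum_lt_top.2 fun v _ => ?_
    split_ifs with h
    · exact ENNReal.mul_lt_top (measure_lt_top _ _) (hC v h)
    · exact ENNReal.zero_lt_top
  refine ⟨(1 + R) * (1 - r)⁻¹, ENNReal.mul_lt_top (by simp [hR])
    (ENNReal.inv_lt_top.2 (tsub_pos_of_lt hr)), fun N => ?_⟩
  induction N with
  | zero => simp [truncMass]
  | succ N ihN =>
    have hsum : ∑ v, (if v ∈ (nbhd G I)ᶜ then μ {v} else 0) * truncMass G μ N (insert v I) ≤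
        μ I * truncMass G μ N I + R := by
      rw [measure_eq_sum μ I, Finset.sum_mul, ← Finset.sum_add_distrib]
      refine Finset.sum_le_sum fun v _ => ?_
      by_cases h1 : v ∈ nbhd G I
      · simp [h1]
      by_cases h2 : v ∈ I
      · simp [h2, h1, Set.insert_eq_of_mem h2]
      · simpa [h1, h2] using mul_le_mul_right (hCle v (by simp [h1, h2]) N) (μ {v})
    calc truncMass G μ (N + 1) I
        ≤ 1 + (μ (nbhd G I)ᶜ * truncMass G μ N I + (μ I * truncMass G μ N I + R)) := by
          rw [truncMass_succ]; gcongr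
      _ = (1 + R) + r * truncMass G μ N I := by ring
      _ ≤ (1 + R) + r * ((1 + R) * (1 - r)⁻¹) := by gcongr
      _ = (1 + R) * ((1 - r) * (1 - r)⁻¹ + r * (1 - r)⁻¹) := by
          rw [ENNReal.mul_inv_cancel (tsub_pos_of_lt hr).ne' (by simp)]; ring
      _ = (1 + R) * (1 - r)⁻¹ := by rw [← add_mul, tsub_add_cancel_of_le hr.le, one_mul]

theorem tsum_contWeight_lt_top [Fintype V] [MeasurableSingletonClass V] [IsProbabilityMeasure μ]
    (hN : NCond G μ) (v : V) : ∑' b, contWeight G μ {v} b < ∞ := by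
  obtain ⟨C, hC, hle⟩ := exists_truncMass_le G μ hN {v} (Set.singleton_nonempty v)
    (Set.pairwise_singleton _ _)
  refine (ENNReal.summable.tsum_le_of_sum_le fun s => ?_).trans_lt hC
  refine le_trans ?_ (hle (s.sup List.length + 1))
  refine le_trans (Finset.sum_le_sum fun b hb => ?_) (ENNReal.sum_le_tsum s)
  rw [if_pos (Nat.lt_succ_of_le (Finset.le_sup (f := List.length) hb))]

theorem tsum_PiB_admB_lt_top [Fintype V] [MeasurableSingletonClass V] [IsProbabilityMeasure μ]
    [DecidableRel G.Adj] (hdeg : ∀ v, ∃ u, G.Adj v u) (hN : NCond G μ) :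
    ∑' b : admB G, PiB μ b.1 < ∞ := by
  classical
  rw [tsum_subtype (admB G) (PiB μ), tsum_list, tsum_fintype, Fintype.sum_sum_type]
  have hinr (a : V) (b : List (V ⊕ V)) :
      (admB G).indicator (PiB μ) (Sum.inr a :: b) = 0 :=
    Set.indicator_of_notMem (fun h => ((mem_admB_iff G hdeg _).1 h).2 a rfl) _
  have hinl (v : V) (b : List (V ⊕ V)) :
      (admB G).indicator (PiB μ) (Sum.inl v :: b) ≤ μ {v} * contWeight G μ {v} b := by
    have := contWeight_inl_cons G μ ∅ v b
    simp only [nbhd_empty, Set.compl_empty, Set.mem_univ, if_true, insert_empty_eq] at this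
    rw [← this]
    refine Set.indicator_apply_le fun h => ?_
    rw [contWeight, if_pos ⟨((mem_admB_iff G hdeg _).1 h).1, by simp⟩]
  simp only [hinr, tsum_zero, Finset.sum_const_zero, add_zero]
  refine ENNReal.add_lt_top.2 ⟨?_, ENNReal.sum_lt_top.2 fun v _ => ?_⟩
  · exact (Set.indicator_le_self _ _ _).trans_lt (by simp)
  · refine (ENNReal.tsum_le_tsum (hinl v)).trans_lt ?_
    rw [ENNReal.tsum_mul_left]
    exact ENNReal.mul_lt_top (measure_lt_top _ _) (tsum_contWeight_lt_top G μ hN v)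

end

/-! ### Invariance of the product form -/

section

variable {V : Type*} (G : SimpleGraph V)

theorem fcfmWord_of_forall_not_adj [DecidableRel G.Adj] {x : List V} {v : V}
    (h : ∀ u ∈ x, ¬ G.Adj v u) : fcfmWord G x v = x ++ [v] := if_pos h

theorem findIdx_eq_length_of_match [DecidableRel G.Adj] {x₁ x₂ : List V} {u v : V}
    (h : ∀ a ∈ x₁, ¬ G.Adj v a) (huv : G.Adj v u) :
    (x₁ ++ u :: x₂).findIdx (fun a => decide (G.Adj v a)) = x₁.length := by
  rw [List.findIdx_append, List.findIdx_eq_length_of_false (by simpa using h)]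
  simp [List.findIdx_cons, huv]

theorem fcfmWord_of_match [DecidableRel G.Adj] {x₁ x₂ : List V} {u v : V}
    (h : ∀ a ∈ x₁, ¬ G.Adj v a) (huv : G.Adj v u) :
    fcfmWord G (x₁ ++ u :: x₂) v = x₁ ++ x₂ := by
  rw [fcfmWord, if_neg, findIdx_eq_length_of_match G h huv]
  · rw [List.eraseIdx_append_of_length_le le_rfl]
    simp
  · exact fun h' => h' u (by simp) huv

theorem exists_first_adj {v : V} {x : List V} (h : ∃ u ∈ x, G.Adj v u) :
    ∃ x₁ u x₂, x = x₁ ++ u :: x₂ ∧ G.Adj v u ∧ ∀ a ∈ x₁, ¬ G.Adj v a := by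
  obtain ⟨x₁, u, x₂, h₁, h₂, h₃⟩ := exists_first_match G (h := x.map Sum.inl)
    (h.imp fun u hu => ⟨List.mem_map_of_mem hu.1, hu.2⟩)
  obtain ⟨l₁, l₂, rfl, rfl, hl⟩ := List.map_eq_append_iff.1 h₁
  obtain ⟨a, l₃, rfl, ha, rfl⟩ := List.map_eq_cons_iff.1 hl
  obtain rfl := Sum.inl_injective ha
  exact ⟨l₁, a, l₃, rfl, h₂, fun b hb => h₃ b (List.mem_map_of_mem hb)⟩

open Classical in
/-- The transition from `x` to `y` under the arrival `v`, in terms of `y`: either `v` has been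
appended, or `x` is `y` with a letter `u` inserted at a place `i` such that `v` is adjacent to `u`
and to none of the first `i` letters. At most one pair `(u, i)` contributes. -/
theorem ite_fcfmWord_eq [Fintype V] [DecidableRel G.Adj] (x y : List V) (v : V) :
    (if fcfmWord G x v = y then (1 : ℝ≥0∞) else 0) =
      (if x ++ [v] = y ∧ ∀ a ∈ x, ¬ G.Adj v a then 1 else 0) +
      ∑ p ∈ Finset.univ ×ˢ Finset.range (y.length + 1),
        if x = y.take p.2 ++ p.1 :: y.drop p.2 ∧ G.Adj v p.1 ∧ ∀ a ∈ y.take p.2, ¬ G.Adj v a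
          then 1 else 0 := by
  by_cases hm : ∃ u ∈ x, G.Adj v u
  · rw [if_neg fun h : x ++ [v] = y ∧ ∀ a ∈ x, ¬ G.Adj v a =>
      hm.elim fun u hu => h.2 u hu.1 hu.2, zero_add]
    by_cases hy : fcfmWord G x v = y
    · obtain ⟨x₁, u, x₂, rfl, huv, hx₁⟩ := exists_first_adj G hm
      rw [fcfmWord_of_match G hx₁ huv] at hy
      subst hy
      rw [if_pos (fcfmWord_of_match G hx₁ huv), Finset.sum_eq_single (u, x₁.length)]
      · rw [if_pos]
        exact ⟨by simp, huv, by simpa using hx₁⟩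
      · rintro ⟨u', i⟩ hi hne
        refine if_neg fun h => hne ?_
        obtain ⟨h1, h2, h3⟩ := h
        have hlen := findIdx_eq_length_of_match G h3 h2 (x₂ := (x₁ ++ x₂).drop i)
        simp only at h1
        rw [← h1, findIdx_eq_length_of_match G hx₁ huv, List.length_take, min_eq_left] at hlen
        · subst hlen
          simpa using h1.symm
        · simpa [Nat.lt_succ_iff] using hi
      · intro h
        simp at h
    · rw [if_neg hy, eq_comm]
      refine Finset.sum_eq_zero fun p _ => if_neg fun h => hy ?_
      rw [h.1, fcfmWord_of_match G h.2.2 h.2.1, List.take_append_drop]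
  · push Not at hm
    rw [fcfmWord_of_forall_not_adj G hm, Finset.sum_eq_zero, add_zero]
    · simp only [and_iff_left hm]
    · exact fun p _ => if_neg fun h => hm p.1 (by simp [h.1]) h.2.1

variable [MeasurableSpace V] (μ : Measure V)

/-- The product forms of the words obtained by inserting `u` into `y` add up to `p(y) μ(u)`, each
weighted by the probability that the next arrival deletes the inserted letter. -/
theorem sum_productForm_insert [Finite V] [MeasurableSingletonClass V] [IsProbabilityMeasure μ]
    (hdeg : ∀ v, ∃ u, G.Adj v u) (hμ : ∀ v, 0 < μ {v}) (y : List V) (u : V) :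
    ∑ i ∈ Finset.range (y.length + 1), productForm G μ (y.take i ++ u :: y.drop i) *
      μ (nbhd G {u} \ nbhd G {a | a ∈ y.take i}) = productForm G μ y * μ {u} := by
  have hne {s : Set V} (hs : s.Nonempty) : μ (nbhd G s) ≠ 0 :=
    (measure_nbhd_pos G μ hdeg hμ hs).ne'
  induction y using List.reverseRecOn with
  | nil =>
    have := productForm_append_singleton G μ [] u
    simp only [List.nil_append, productForm_nil, one_mul, List.mem_singleton] at this
    have hs : {a | a = u} = ({u} : Set V) := rfl
    simp only [List.length_nil, zero_add, Finset.range_one, Finset.sum_singleton,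
      List.take_nil, List.drop_nil, List.nil_append, this, hs, productForm_nil, one_mul,
      List.not_mem_nil, Set.ofPred_false, nbhd_empty, Set.sdiff_empty]
    exact ENNReal.div_mul_cancel (hne (Set.singleton_nonempty u)) (measure_ne_top _ _)
  | append_singleton y w ih =>
    set E := nbhd G {a | a ∈ y ++ [w]} with hE
    set E' := nbhd G ({a | a ∈ y ++ [w]} ∪ {u}) with hE'
    have hmE : μ E ≠ 0 := hne ⟨w, by simp⟩
    have hmE' : μ E' ≠ 0 := hne ⟨u, by simp⟩
    have hsplit : μ E' = μ E + μ (nbhd G {u} \ E) := by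
      rw [hE', nbhd_union, ← hE, ← Set.union_sdiff_self,
        measure_union Set.disjoint_sdiff_right (Set.toFinite _).measurableSet]
    have hterm (i : ℕ) (hi : i ∈ Finset.range (y.length + 1)) :
        productForm G μ ((y ++ [w]).take i ++ u :: (y ++ [w]).drop i) *
          μ (nbhd G {u} \ nbhd G {a | a ∈ (y ++ [w]).take i}) =
        productForm G μ (y.take i ++ u :: y.drop i) *
          μ (nbhd G {u} \ nbhd G {a | a ∈ y.take i}) * (μ {w} / μ E') := by
      have hi : i ≤ y.length := Nat.lt_succ_iff.1 (Finset.mem_range.1 hi)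
      have hset : {a | a ∈ y.take i ++ u :: y.drop i ++ [w]} =
          {a | a ∈ y ++ [w]} ∪ {u} := by
        ext a
        conv_rhs => rw [← List.take_append_drop i y]
        simp only [List.mem_append, List.mem_cons, Set.mem_ofPred_eq, Set.mem_union,
          Set.mem_singleton_iff, List.not_mem_nil]
        tauto
      rw [List.take_append_of_le_length hi, List.drop_append_of_le_length hi,
        ← List.cons_append, ← List.append_assoc, productForm_append_singleton, hset]
      ring
    have hlast : productForm G μ (y ++ [w] ++ [u]) =
        productForm G μ (y ++ [w]) * (μ {u} / μ E') := by
      rw [productForm_append_singleton, ofPred_mem_append_singleton]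
    rw [List.length_append, List.length_singleton, Finset.sum_range_succ,
      Finset.sum_congr rfl hterm, ← Finset.sum_mul, ih, List.take_of_length_le (by simp),
      List.drop_of_length_le (by simp), hlast, ← hE]
    have hy : productForm G μ y * μ {w} = productForm G μ (y ++ [w]) * μ E := by
      rw [productForm_append_singleton, mul_assoc,
        ENNReal.div_mul_cancel hmE (measure_ne_top _ _)]
    calc productForm G μ y * μ {u} * (μ {w} / μ E') +
          productForm G μ (y ++ [w]) * (μ {u} / μ E') * μ (nbhd G {u} \ E)
        = (productForm G μ y * μ {w}) * μ {u} * (μ E')⁻¹ +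
          productForm G μ (y ++ [w]) * μ {u} * (μ E')⁻¹ * μ (nbhd G {u} \ E) := by
          simp only [div_eq_mul_inv]; ring
      _ = productForm G μ (y ++ [w]) * μ {u} * ((μ E + μ (nbhd G {u} \ E)) * (μ E')⁻¹) := by
          rw [hy]; ring
      _ = productForm G μ (y ++ [w]) * μ {u} := by
          rw [← hsplit, ENNReal.mul_inv_cancel hmE' (measure_ne_top _ _), mul_one]

variable [DecidableRel G.Adj]

/-- The product form, extended by `0` to the words that are not queue details. -/
noncomputable def admForm (w : List V) : ℝ≥0∞ :=
  if ∀ i ∈ w, ∀ j ∈ w, ¬ G.Adj i j then productForm G μ w else 0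

open Classical in
theorem sum_append_admForm [Fintype V] [IsProbabilityMeasure μ]
    (hdeg : ∀ v, ∃ u, G.Adj v u) (hμ : ∀ v, 0 < μ {v}) (y : List V)
    (hy : ∀ i ∈ y, ∀ j ∈ y, ¬ G.Adj i j) :
    ∑ v, μ {v} * ∑' x : List V, admForm G μ x *
      (if x ++ [v] = y ∧ ∀ a ∈ x, ¬ G.Adj v a then 1 else 0) =
      productForm G μ y * μ (nbhd G {a | a ∈ y}) := by
  rcases List.eq_nil_or_concat' y with rfl | ⟨y, w, rfl⟩
  · simp
  · have hE : μ (nbhd G {a | a ∈ y ++ [w]}) ≠ 0 :=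
      (measure_nbhd_pos G μ hdeg hμ ⟨w, by simp⟩).ne'
    rw [Finset.sum_eq_single w, tsum_eq_single y, if_pos, admForm, if_pos,
      productForm_append_singleton, mul_assoc, ENNReal.div_mul_cancel hE (measure_ne_top _ _),
      mul_one, mul_comm]
    · exact fun i hi j hj => hy i (by simp [hi]) j (by simp [hj])
    · exact ⟨rfl, fun a ha => hy w (by simp) a (by simp [ha])⟩
    · intro x hx
      rw [if_neg, mul_zero]
      exact fun h => hx (by simpa using h.1)
    · intro v _ hv
      rw [ENNReal.tsum_eq_zero.2, mul_zero]
      intro x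
      rw [if_neg, mul_zero]
      exact fun h => hv (by simpa using (List.append_inj' h.1 rfl).2)
    · simp

open Classical in
theorem sum_insert_admForm [Fintype V] [MeasurableSingletonClass V] [IsProbabilityMeasure μ]
    (hdeg : ∀ v, ∃ u, G.Adj v u) (hμ : ∀ v, 0 < μ {v}) (y : List V)
    (hy : ∀ i ∈ y, ∀ j ∈ y, ¬ G.Adj i j) :
    ∑ v, μ {v} * ∑' x : List V, admForm G μ x *
      ∑ p ∈ Finset.univ ×ˢ Finset.range (y.length + 1),
        (if x = y.take p.2 ++ p.1 :: y.drop p.2 ∧ G.Adj v p.1 ∧ ∀ a ∈ y.take p.2, ¬ G.Adj v a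
          then 1 else 0) =
      productForm G μ y * μ (nbhd G {a | a ∈ y})ᶜ := by
  have hadm (u : V) (i : ℕ) : admForm G μ (y.take i ++ u :: y.drop i) =
      if u ∈ (nbhd G {a | a ∈ y})ᶜ then productForm G μ (y.take i ++ u :: y.drop i) else 0 := by
    have hmem (a : V) : a ∈ y.take i ++ u :: y.drop i ↔ a = u ∨ a ∈ y := by
      conv_rhs => rw [← List.take_append_drop i y]
      simp only [List.mem_append, List.mem_cons]
      tauto
    have hiff : (∀ a ∈ y.take i ++ u :: y.drop i, ∀ b ∈ y.take i ++ u :: y.drop i,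
        ¬ G.Adj a b) ↔ u ∈ (nbhd G {a | a ∈ y})ᶜ := by
      simp only [hmem, nbhd, Set.mem_compl_iff, Set.mem_ofPred_eq, not_exists, not_and]
      constructor
      · exact fun h a ha => h a (Or.inr ha) u (Or.inl rfl)
      · rintro h a (rfl | ha) b (rfl | hb)
        · exact G.irrefl
        · exact fun hab => h b hb hab.symm
        · exact h a ha
        · exact hy a ha b hb
    simp only [admForm, hiff]
  have hinner (v : V) : ∑' x : List V, admForm G μ x *
      ∑ p ∈ Finset.univ ×ˢ Finset.range (y.length + 1),
        (if x = y.take p.2 ++ p.1 :: y.drop p.2 ∧ G.Adj v p.1 ∧ ∀ a ∈ y.take p.2, ¬ G.Adj v a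
          then (1 : ℝ≥0∞) else 0) =
      ∑ p ∈ Finset.univ ×ˢ Finset.range (y.length + 1),
        admForm G μ (y.take p.2 ++ p.1 :: y.drop p.2) *
          if v ∈ nbhd G {p.1} \ nbhd G {a | a ∈ y.take p.2} then 1 else 0 := by
    simp_rw [Finset.mul_sum]
    rw [Summable.tsum_finsetSum fun _ _ => ENNReal.summable]
    refine Finset.sum_congr rfl fun p _ => ?_
    rw [tsum_eq_single (y.take p.2 ++ p.1 :: y.drop p.2)]
    · congr 1
      refine if_congr ?_ rfl rfl
      simp [nbhd, G.adj_comm v]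
    · intro x hx
      rw [if_neg fun h => hx h.1, mul_zero]
  simp_rw [hinner, Finset.mul_sum]
  rw [Finset.sum_comm, Finset.sum_product, measure_eq_sum μ (_ᶜ), Finset.mul_sum]
  refine Finset.sum_congr rfl fun u _ => ?_
  have hmeas (i : ℕ) : ∑ v, μ {v} * (admForm G μ (y.take i ++ u :: y.drop i) *
      if v ∈ nbhd G {u} \ nbhd G {a | a ∈ y.take i} then 1 else 0) =
      admForm G μ (y.take i ++ u :: y.drop i) *
        μ (nbhd G {u} \ nbhd G {a | a ∈ y.take i}) := by
    rw [measure_eq_sum μ (_ \ _), Finset.mul_sum]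
    refine Finset.sum_congr rfl fun v _ => ?_
    split_ifs <;> simp [mul_comm]
  simp only [hmeas]
  simp only [hadm]
  split_ifs
  · exact sum_productForm_insert G μ hdeg hμ y u
  · simp

open Classical in
theorem measure_fcfm_eq [Fintype V] [MeasurableSingletonClass V] (w w' : QueueDetail G) :
    μ {v | fcfm G w v = w'} = ∑ v, μ {v} * if fcfmWord G w.1 v = w'.1 then 1 else 0 := by
  rw [measure_eq_sum]
  refine Finset.sum_congr rfl fun v _ => ?_
  have : fcfm G w v = w' ↔ fcfmWord G w.1 v = w'.1 := Subtype.ext_iff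
  simp [this]

theorem tsum_productForm_mul [Fintype V] [MeasurableSingletonClass V] [IsProbabilityMeasure μ]
    (hdeg : ∀ v, ∃ u, G.Adj v u) (hμ : ∀ v, 0 < μ {v}) (y : QueueDetail G) :
    ∑' w : QueueDetail G, productForm G μ w.1 * μ {v | fcfm G w v = y} =
      productForm G μ y.1 := by
  classical
  calc ∑' w : QueueDetail G, productForm G μ w.1 * μ {v | fcfm G w v = y}
      = ∑ v, μ {v} * ∑' w : QueueDetail G,
          productForm G μ w.1 * if fcfmWord G w.1 v = y.1 then 1 else 0 := by
        simp_rw [measure_fcfm_eq, Finset.mul_sum, ← ENNReal.tsum_mul_left]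
        rw [Summable.tsum_finsetSum fun _ _ => ENNReal.summable]
        simp_rw [mul_left_comm]
    _ = ∑ v, μ {v} * ∑' x : List V,
          admForm G μ x * if fcfmWord G x v = y.1 then 1 else 0 := by
        refine Finset.sum_congr rfl fun v _ => ?_
        rw [tsum_queueDetail G fun w =>
          productForm G μ w * if fcfmWord G w v = y.1 then 1 else 0]
        congr 2
        ext x
        rw [admForm, ite_zero_mul]
        congr
    _ = productForm G μ y.1 := by
        simp_rw [ite_fcfmWord_eq, mul_add, ENNReal.tsum_add, mul_add, Finset.sum_add_distrib]
        rw [sum_append_admForm G μ hdeg hμ y.1 y.2, sum_insert_admForm G μ hdeg hμ y.1 y.2,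
          ← mul_add, prob_add_prob_compl (Set.toFinite _).measurableSet, mul_one]

end

/-! ### Return times and taboo operators -/

section

variable {V : Type*} (G : SimpleGraph V) [DecidableRel G.Adj]

open Classical in
/-- The transition operator of the natural chain killed at the state `w`, for arrivals of law `p`.
The semiring is arbitrary, so that the same iterates may be read in `ℝ≥0∞` and in `ℝ`. -/
noncomputable def tabooOp [Fintype V] {R : Type*} [CommSemiring R] (p : V → R)
    (w : QueueDetail G) (f : QueueDetail G → R) (x : QueueDetail G) : R :=
  ∑ v, p v * if fcfm G x v = w then 0 else f (fcfm G x v)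

theorem map_iterate_tabooOp [Fintype V] {R S : Type*} [CommSemiring R] [CommSemiring S]
    (φ : R →+* S) (p : V → R) (w : QueueDetail G) (n : ℕ) (x : QueueDetail G) :
    φ ((tabooOp G p w)^[n] 1 x) = (tabooOp G (φ ∘ p) w)^[n] 1 x := by
  induction n generalizing x with
  | zero => simp
  | succ n ih =>
    rw [Function.iterate_succ_apply', Function.iterate_succ_apply', tabooOp, tabooOp, map_sum]
    refine Finset.sum_congr rfl fun v _ => ?_
    rw [map_mul, apply_ite φ, ih, map_zero]
    rfl

/-- The chain started from the second argument and driven by the given arrivals is never at `w`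
after its start. -/
def Avoids (w : QueueDetail G) : QueueDetail G → List V → Prop
  | _, [] => True
  | x, v :: z => fcfm G x v ≠ w ∧ Avoids w (fcfm G x v) z

open Classical in
theorem iterate_tabooOp_eq_sum [Fintype V] {R : Type*} [CommSemiring R] (p : V → R)
    (w : QueueDetail G) (n : ℕ) (x : QueueDetail G) :
    (tabooOp G p w)^[n] 1 x =
      ∑ z : Fin n → V, if Avoids G w x (List.ofFn z) then ∏ i, p (z i) else 0 := by
  induction n generalizing x with
  | zero => simp [Avoids]
  | succ n ih =>
    rw [Function.iterate_succ_apply', tabooOp, ← (Fin.consEquiv fun _ => V).sum_comp,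
      Fintype.sum_prod_type]
    refine Finset.sum_congr rfl fun v _ => ?_
    by_cases h : fcfm G x v = w
    · simp [h, Avoids, Fin.consEquiv, List.ofFn_succ]
    · simp [h, Avoids, Fin.consEquiv, List.ofFn_succ, ih, Finset.mul_sum, Fin.prod_univ_succ]

section Chain

variable {Ω : Type*}

theorem naturalChain_succ_eq (A : ℕ → Ω → V) (x : QueueDetail G) (k : ℕ) (ω : Ω) :
    naturalChain G A x (k + 1) ω =
      naturalChain G (fun n => A (n + 1)) (fcfm G x (A 0 ω)) k ω := by
  induction k with
  | zero => rfl
  | succ k ih => rw [naturalChain, ih, naturalChain]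

theorem avoids_ofFn_iff (A : ℕ → Ω → V) (w x : QueueDetail G) (n : ℕ) (ω : Ω) :
    Avoids G w x (List.ofFn fun i : Fin n => A i ω) ↔
      ∀ k, 1 ≤ k → k ≤ n → naturalChain G A x k ω ≠ w := by
  induction n generalizing A x with
  | zero => simp [Avoids]; omega
  | succ n ih =>
    have := ih (fun n => A (n + 1)) (fcfm G x (A 0 ω))
    simp only [List.ofFn_succ, Avoids, Fin.val_zero, Fin.val_succ, this,
      ← naturalChain_succ_eq]
    constructor
    · rintro ⟨h0, h⟩ k hk hkn
      obtain ⟨k, rfl⟩ := Nat.exists_eq_add_of_le' hk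
      rcases k with _ | k
      · exact h0
      · exact h (k + 1) (by omega) (by omega)
    · exact fun h => ⟨h 1 le_rfl (by omega), fun k hk hkn => h (k + 1) (by omega) (by omega)⟩

open Classical in
/-- The return time is the number of the `n` such that `w` is avoided at the times `1, …, n`. -/
theorem returnTime_eq_tsum (A : ℕ → Ω → V) (w : QueueDetail G) (ω : Ω) :
    returnTime G A w ω =
      ∑' n : ℕ, if Avoids G w w (List.ofFn fun i : Fin n => A i ω) then 1 else 0 := by
  simp only [avoids_ofFn_iff]
  by_cases h : ∃ k, 1 ≤ k ∧ naturalChain G A w k ω = w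
  · have hmin (m : ℕ) (hm : m < Nat.find h) := Nat.find_min h hm
    obtain ⟨h1, h2⟩ := Nat.find_spec h
    set N := Nat.find h
    have hiff (n : ℕ) : (∀ k, 1 ≤ k → k ≤ n → naturalChain G A w k ω ≠ w) ↔
        n ∈ Finset.range N := by
      rw [Finset.mem_range]
      constructor
      · exact fun h' => lt_of_not_ge fun hn => h' N h1 hn h2
      · exact fun hn k hk hkn hw => hmin k (hkn.trans_lt hn) ⟨hk, hw⟩
    simp only [hiff]
    rw [tsum_eq_sum (s := Finset.range N) fun n hn => if_neg hn,
      Finset.sum_congr rfl fun n hn => if_pos hn]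
    simp only [Finset.sum_const, Finset.card_range, nsmul_eq_mul, mul_one]
    refine le_antisymm (iInf₂_le N ⟨h1, h2⟩) (le_iInf₂ fun n hn => ?_)
    exact Nat.cast_le.2 (Nat.find_min' h hn)
  · push Not at h
    have h1 : ∀ n k, 1 ≤ k → k ≤ n → naturalChain G A w k ω ≠ w := fun n k hk _ => h k hk
    have h2 : returnTime G A w ω = ∞ := by
      simp only [returnTime, iInf_eq_top]
      exact fun n hn => absurd hn.2 (h n hn.1)
    rw [h2, tsum_congr fun n => if_pos (h1 n)]
    simp

variable [Fintype V] [MeasurableSpace V] [MeasurableSingletonClass V] [MeasurableSpace Ω]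
  {P : Measure Ω} [IsProbabilityMeasure P] {A : ℕ → Ω → V} {μ : Measure V}

theorem measure_avoids (hA : ∀ n, Measurable (A n)) (hlaw : ∀ n, P.map (A n) = μ)
    (hindep : iIndepFun A P) (w : QueueDetail G) (n : ℕ) :
    P {ω | Avoids G w w (List.ofFn fun i : Fin n => A i ω)} =
      (tabooOp G (fun v => μ {v}) w)^[n] 1 w := by
  classical
  have : IsProbabilityMeasure μ := hlaw 0 ▸ Measure.isProbabilityMeasure_map (hA 0).aemeasurable
  have hmap : P.map (fun ω (i : Fin n) => A i ω) = Measure.pi fun _ => μ := by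
    have h := (iIndepFun_iff_map_fun_eq_pi_map fun i : Fin n => (hA i).aemeasurable).1
      (hindep.precomp Fin.val_injective)
    simpa only [hlaw] using h
  have hmeas : Measurable fun ω (i : Fin n) => A i ω := measurable_pi_lambda _ fun i => hA i
  change P ((fun ω (i : Fin n) => A i ω) ⁻¹' {z | Avoids G w w (List.ofFn z)}) = _
  rw [← Measure.map_apply hmeas (Set.toFinite _).measurableSet,
    hmap, measure_eq_sum, iterate_tabooOp_eq_sum]
  simp [Measure.pi_singleton]

theorem lintegral_returnTime (hA : ∀ n, Measurable (A n)) (hlaw : ∀ n, P.map (A n) = μ)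
    (hindep : iIndepFun A P) (w : QueueDetail G) :
    ∫⁻ ω, returnTime G A w ω ∂P = ∑' n, (tabooOp G (fun v => μ {v}) w)^[n] 1 w := by
  classical
  have hmeas (n : ℕ) : MeasurableSet {ω | Avoids G w w (List.ofFn fun i : Fin n => A i ω)} :=
    (measurable_pi_lambda (fun ω (i : Fin n) => A i ω) fun i => hA i)
      (Set.toFinite {z : Fin n → V | Avoids G w w (List.ofFn z)}).measurableSet
  simp only [returnTime_eq_tsum]
  rw [lintegral_tsum fun n => (Measurable.ite (hmeas n) measurable_const
    measurable_const).aemeasurable]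
  refine tsum_congr fun n => ?_
  rw [← measure_avoids G hA hlaw hindep, ← lintegral_indicator_one (hmeas n)]
  simp only [Set.indicator_apply, Set.mem_ofPred_eq, Pi.one_apply]

end Chain

section Stationary

variable [Fintype V] [MeasurableSpace V] [MeasurableSingletonClass V] (μ : Measure V)

/-- A stationary measure integrates a function after one step as it does before. -/
theorem tsum_mul_step {π : QueueDetail G → ℝ≥0∞}
    (hπ : ∀ y, π y = ∑' x, π x * μ {v | fcfm G x v = y}) (h : QueueDetail G → ℝ≥0∞) :
    ∑' x, π x * ∑ v, μ {v} * h (fcfm G x v) = ∑' y, π y * h y := by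
  classical
  have hstep (x : QueueDetail G) :
      ∑ v, μ {v} * h (fcfm G x v) = ∑' y, μ {v | fcfm G x v = y} * h y := by
    simp_rw [measure_eq_sum μ {v | fcfm G x v = _}, Finset.sum_mul]
    rw [Summable.tsum_finsetSum fun _ _ => ENNReal.summable]
    refine Finset.sum_congr rfl fun v _ => ?_
    rw [tsum_eq_single (fcfm G x v)]
    · simp
    · intro y hy
      simp [hy.symm]
  simp_rw [hstep, ← ENNReal.tsum_mul_left]
  rw [ENNReal.tsum_comm]
  refine tsum_congr fun y => ?_
  rw [hπ y, ← ENNReal.tsum_mul_right]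
  simp_rw [mul_assoc]

/-- The upper bound in Kac's formula: the mean return time to `w` is at most `1 / π(w)`. -/
theorem mul_tsum_iterate_tabooOp_le {π : QueueDetail G → ℝ≥0∞}
    (hπ : ∀ y, π y = ∑' x, π x * μ {v | fcfm G x v = y}) (hone : ∑' x, π x = 1)
    (w : QueueDetail G) :
    π w * ∑' n, (tabooOp G (fun v => μ {v}) w)^[n] 1 w ≤ 1 := by
  classical
  set u : ℕ → QueueDetail G → ℝ≥0∞ := fun n => (tabooOp G (fun v => μ {v}) w)^[n] 1
  have hrec (n : ℕ) : ∑' x, π x * u (n + 1) x + π w * u n w = ∑' x, π x * u n x := by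
    have h1 : ∑' x, π x * u (n + 1) x = ∑' y, π y * if y = w then 0 else u n y := by
      rw [← tsum_mul_step G μ hπ fun y => if y = w then 0 else u n y]
      refine tsum_congr fun x => ?_
      simp only [u]
      rw [Function.iterate_succ_apply', tabooOp]
    have h2 : π w * u n w = ∑' y, π y * if y = w then u n y else 0 := by
      rw [tsum_eq_single w]
      · simp
      · intro y hy
        simp [hy]
    rw [h1, h2, ← ENNReal.tsum_add]
    refine tsum_congr fun y => ?_
    split_ifs <;> simp
  have hsum (N : ℕ) : ∑' x, π x * u N x + ∑ n ∈ Finset.range N, π w * u n w = 1 := by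
    induction N with
    | zero => simpa [u] using hone
    | succ N ih => rw [Finset.sum_range_succ, add_comm (∑ _ ∈ _, _), ← add_assoc, hrec, ih]
  -- Telescoping of `hrec`.
  rw [← ENNReal.tsum_mul_left]
  exact ENNReal.tsum_le_of_sum_range_le fun N => (hsum N) ▸ le_add_self

end Stationary

end

/-! ### Instability when the condition fails -/

section

variable {V : Type*} (G : SimpleGraph V)

theorem exists_adj_of_not_isBipartite (hconn : G.Connected) (hG : ¬ G.IsBipartite) (v : V) :
    ∃ u, G.Adj v u := by
  by_contra! h
  have hv (u : V) : u = v := by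
    obtain ⟨p⟩ := hconn.preconnected v u
    cases p with
    | nil => rfl
    | cons hadj _ => exact absurd hadj (h _)
  exact hG ⟨SimpleGraph.Coloring.mk (fun _ => 0) fun {a b} hab =>
    absurd (hv a ▸ hab) (h b)⟩

/-- If `s u + s v = 0` held on all edges, the sign of `s` would be a two-colouring of the graph. -/
theorem exists_adj_add_neg (hconn : G.Connected) (hG : ¬ G.IsBipartite) {s : V → ℝ} {i : V}
    (hi : s i ≠ 0) (hs : ∀ u v, G.Adj u v → s u + s v ≤ 0) :
    ∃ u v, G.Adj u v ∧ s u + s v < 0 := by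
  by_contra! h
  have hneg (u v : V) (huv : G.Adj u v) : s v = -s u := by
    linarith [h u v huv, hs u v huv]
  have hne (v : V) : s v ≠ 0 := by
    obtain ⟨p⟩ := hconn.preconnected v i
    induction p with
    | nil => exact hi
    | cons hadj _ ih => exact fun h0 => ih hi (by rw [hneg _ _ hadj, h0, neg_zero])
  have hcol : G.Coloring Bool := SimpleGraph.Coloring.mk (fun v => decide (0 < s v))
    fun {u v} huv heq => by
      rw [decide_eq_decide, hneg u v huv, neg_pos] at heq
      rcases lt_or_gt_of_ne (hne u) with h1 | h1
      · exact lt_asymm h1 (heq.2 h1)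
      · exact lt_asymm h1 (heq.1 h1)
  exact hG hcol.colorable

/-- The empty word, as a state of the natural chain. -/
def emptyQueue : QueueDetail G := ⟨[], by simp⟩

/-- The sum of `s` over the letters of a word. -/
def wordSum (s : V → ℝ) (x : QueueDetail G) : ℝ := (x.1.map s).sum

theorem wordSum_le_length {s : V → ℝ} (hs : ∀ v, s v ≤ 1) (x : QueueDetail G) :
    wordSum G s x ≤ x.1.length := by
  simpa [wordSum] using List.sum_le_card_nsmul (x.1.map s) 1 (by simpa using fun v _ => hs v)

variable [DecidableRel G.Adj]

theorem le_wordSum_fcfm {s : V → ℝ} (hs : ∀ u v, G.Adj u v → s u + s v ≤ 0)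
    (x : QueueDetail G) (v : V) : wordSum G s x + s v ≤ wordSum G s (fcfm G x v) := by
  unfold wordSum fcfm
  by_cases hm : ∃ u ∈ x.1, G.Adj v u
  · obtain ⟨x₁, u, x₂, hx, huv, hx₁⟩ := exists_first_adj G hm
    simp only [hx, fcfmWord_of_match G hx₁ huv]
    simp only [List.map_append, List.map_cons, List.sum_append, List.sum_cons]
    linarith [hs v u huv]
  · push Not at hm
    simp [fcfmWord_of_forall_not_adj G hm]

theorem length_fcfm_le (x : QueueDetail G) (v : V) :
    (fcfm G x v).1.length ≤ x.1.length + 1 := by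
  change (fcfmWord G x.1 v).length ≤ _
  unfold fcfmWord
  split_ifs
  · simp
  · exact (List.length_eraseIdx_le _ _).trans (Nat.le_succ _)

variable [Fintype V]

theorem tabooOp_mono {p : V → ℝ} (hp : ∀ v, 0 ≤ p v) (w : QueueDetail G) :
    Monotone (tabooOp G p w) := by
  intro f g hfg x
  refine Finset.sum_le_sum fun v _ => mul_le_mul_of_nonneg_left ?_ (hp v)
  split_ifs
  · exact le_rfl
  · exact hfg _

theorem tabooOp_wordSum (p s : V → ℝ) (x : QueueDetail G) :
    tabooOp G p (emptyQueue G) (wordSum G s) x = ∑ v, p v * wordSum G s (fcfm G x v) := by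
  refine Finset.sum_congr rfl fun v _ => ?_
  split_ifs with h
  · simp [h, wordSum, emptyQueue]
  · rfl

theorem wordSum_le_tabooOp {p s : V → ℝ} (hp : ∀ v, 0 ≤ p v) (hp1 : ∑ v, p v = 1)
    (hs : ∀ u v, G.Adj u v → s u + s v ≤ 0) (hdrift : 0 ≤ ∑ v, p v * s v)
    (x : QueueDetail G) :
    wordSum G s x ≤ tabooOp G p (emptyQueue G) (wordSum G s) x := by
  rw [tabooOp_wordSum]
  calc wordSum G s x ≤ (∑ v, p v) * wordSum G s x + ∑ v, p v * s v := by
        rw [hp1, one_mul]; linarith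
    _ = ∑ v, p v * (wordSum G s x + s v) := by
        simp_rw [mul_add, Finset.sum_add_distrib, Finset.sum_mul]
    _ ≤ _ := Finset.sum_le_sum fun v _ =>
        mul_le_mul_of_nonneg_left (le_wordSum_fcfm G hs x v) (hp v)

/-- Two arrivals `a`, `b` joined by an edge lead from the empty word back to it, and `wordSum`
then exceeds the sum of the arrivals by the gap `-(s a + s b)`. -/
theorem gap_le_tabooOp_tabooOp {p s : V → ℝ} (hp : ∀ v, 0 ≤ p v) (hp1 : ∑ v, p v = 1)
    (hs : ∀ u v, G.Adj u v → s u + s v ≤ 0) (hdrift : 0 ≤ ∑ v, p v * s v)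
    {a b : V} (hab : G.Adj a b) :
    p a * (p b * -(s a + s b)) ≤
      tabooOp G p (emptyQueue G) (tabooOp G p (emptyQueue G) (wordSum G s)) (emptyQueue G) := by
  classical
  have hsingle (v : V) : (fcfm G (emptyQueue G) v).1 = [v] :=
    fcfmWord_of_forall_not_adj G (x := []) (by simp)
  have hM (v : V) : wordSum G s (fcfm G (emptyQueue G) v) = s v := by
    simp [wordSum, hsingle]
  have ha : s a + p b * -(s a + s b) ≤
      tabooOp G p (emptyQueue G) (wordSum G s) (fcfm G (emptyQueue G) a) := by
    rw [tabooOp_wordSum]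
    calc s a + p b * -(s a + s b) ≤
          (∑ v, p v) * s a + ∑ v, p v * s v + p b * -(s a + s b) := by
          rw [hp1, one_mul]; linarith
      _ = ∑ v, p v * (s a + s v + if v = b then -(s a + s b) else 0) := by
          simp_rw [mul_add, Finset.sum_add_distrib, Finset.sum_mul]
          simp
      _ ≤ _ := by
          refine Finset.sum_le_sum fun v _ => mul_le_mul_of_nonneg_left ?_ (hp v)
          split_ifs with hv
          · subst hv
            have : (fcfm G (fcfm G (emptyQueue G) a) v).1 = [] := by
              change fcfmWord G (fcfm G (emptyQueue G) a).1 v = []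
              rw [hsingle]
              exact fcfmWord_of_match G (x₁ := []) (by simp) hab.symm
            simp [wordSum, this]
          · have := le_wordSum_fcfm G hs (fcfm G (emptyQueue G) a) v
            rw [hM] at this
            linarith
  calc p a * (p b * -(s a + s b))
      ≤ ∑ v, p v * s v + p a * (p b * -(s a + s b)) := by linarith
    _ = ∑ v, p v * (s v + if v = a then p b * -(s a + s b) else 0) := by
        simp_rw [mul_add, Finset.sum_add_distrib]
        simp
    _ ≤ _ := by
        refine Finset.sum_le_sum fun v _ => mul_le_mul_of_nonneg_left ?_ (hp v)
        rw [if_neg fun h : fcfm G (emptyQueue G) v = emptyQueue G => by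
          simpa [emptyQueue] using (hsingle v).symm.trans (congrArg Subtype.val h)]
        split_ifs with hv
        · exact hv ▸ ha
        · have := wordSum_le_tabooOp G hp hp1 hs hdrift (fcfm G (emptyQueue G) v)
          rw [hM] at this
          linarith

theorem iterate_tabooOp_wordSum_le {p s : V → ℝ} (hp : ∀ v, 0 ≤ p v)
    (hs1 : ∀ v, s v ≤ 1) (w : QueueDetail G) (n : ℕ) (x : QueueDetail G) :
    (tabooOp G p w)^[n] (wordSum G s) x ≤ (x.1.length + n) * (tabooOp G p w)^[n] 1 x := by
  have hpos (n : ℕ) (x : QueueDetail G) : 0 ≤ (tabooOp G p w)^[n] 1 x := by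
    classical
    rw [iterate_tabooOp_eq_sum]
    refine Finset.sum_nonneg fun z _ => ?_
    split_ifs
    · exact Finset.prod_nonneg fun i _ => hp _
    · exact le_rfl
  induction n generalizing x with
  | zero => simpa using wordSum_le_length G hs1 x
  | succ n ih =>
    rw [Function.iterate_succ_apply', Function.iterate_succ_apply', tabooOp, tabooOp,
      Finset.mul_sum]
    refine Finset.sum_le_sum fun v _ => ?_
    rw [mul_left_comm]
    refine mul_le_mul_of_nonneg_left ?_ (hp v)
    split_ifs
    · simp
    · refine (ih _).trans (mul_le_mul_of_nonneg_right ?_ (hpos n _))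
      have : ((fcfm G x v).1.length : ℝ) ≤ x.1.length + 1 := by
        exact_mod_cast length_fcfm_le G x v
      push_cast
      linarith

theorem not_summable_iterate_tabooOp {p s : V → ℝ} (hp : ∀ v, 0 < p v) (hp1 : ∑ v, p v = 1)
    (hs1 : ∀ v, s v ≤ 1) (hs : ∀ u v, G.Adj u v → s u + s v ≤ 0)
    (hdrift : 0 ≤ ∑ v, p v * s v) {a b : V} (hab : G.Adj a b) (hlt : s a + s b < 0) :
    ¬ Summable fun n => (tabooOp G p (emptyQueue G))^[n] 1 (emptyQueue G) := by
  intro hsum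
  have hp0 (v : V) : 0 ≤ p v := (hp v).le
  set K := tabooOp G p (emptyQueue G)
  have hc : 0 < p a * (p b * -(s a + s b)) :=
    mul_pos (hp a) (mul_pos (hp b) (neg_pos.2 hlt))
  set c := p a * (p b * -(s a + s b))
  have hK : Monotone K := tabooOp_mono G hp0 _
  have hmono : Monotone fun n => K^[n] (wordSum G s) :=
    hK.monotone_iterate_of_le_map (wordSum_le_tabooOp G hp0 hp1 hs hdrift)
  have hlow (n : ℕ) : c * (1 / ((n + 2 : ℕ) : ℝ)) ≤ K^[n + 2] 1 (emptyQueue G) := by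
    have h1 : c ≤ K^[n + 2] (wordSum G s) (emptyQueue G) :=
      (gap_le_tabooOp_tabooOp G hp0 hp1 hs hdrift hab).trans
        (hmono (Nat.le_add_left 2 n) (emptyQueue G))
    have h2 := iterate_tabooOp_wordSum_le G hp0 hs1 (emptyQueue G) (n + 2) (emptyQueue G)
    rw [mul_one_div, div_le_iff₀ (by positivity), mul_comm]
    refine h1.trans (h2.trans_eq ?_)
    simp [emptyQueue, K]
  have h3 : Summable fun n : ℕ => c * (1 / ((n + 2 : ℕ) : ℝ)) :=
    Summable.of_nonneg_of_le (fun n => by positivity) hlow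
      ((summable_nat_add_iff (f := fun n => K^[n] 1 (emptyQueue G)) 2).2 hsum)
  rw [summable_mul_left_iff hc.ne'] at h3
  exact Real.not_summable_one_div_natCast
    ((summable_nat_add_iff (f := fun n : ℕ => 1 / (n : ℝ)) 2).1 h3)

variable [MeasurableSpace V] [MeasurableSingletonClass V] (μ : Measure V)
  [IsProbabilityMeasure μ]

theorem nCond_of_tsum_lt_top (hconn : G.Connected) (hG : ¬ G.IsBipartite) (hμ : ∀ v, 0 < μ {v})
    (hfin : ∑' n, (tabooOp G (fun v => μ {v}) (emptyQueue G))^[n] 1 (emptyQueue G) < ∞) :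
    NCond G μ := by
  classical
  intro I hne hI
  by_contra! hle
  set s : V → ℝ := fun v => (if v ∈ I then 1 else 0) - if v ∈ nbhd G I then 1 else 0
  have hdisj (v : V) (hv : v ∈ I) : v ∉ nbhd G I := fun ⟨u, hu, huv⟩ =>
    hI hu hv (G.ne_of_adj huv) huv
  have hs : ∀ u v, G.Adj u v → s u + s v ≤ 0 := by
    intro u v huv
    by_cases hu : u ∈ I
    · have h2 : v ∈ nbhd G I := ⟨u, hu, huv⟩
      have h3 : v ∉ I := fun h => hdisj v h h2
      simp [s, hu, hdisj u hu, h2, h3]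
    · by_cases hv : v ∈ I
      · have h2 : u ∈ nbhd G I := ⟨v, hv, huv.symm⟩
        simp [s, hv, hdisj v hv, h2, hu]
      · simp only [s, hu, hv, if_false]
        split_ifs <;> norm_num
  have hs1 (v : V) : s v ≤ 1 := by
    simp only [s]
    split_ifs <;> norm_num
  obtain ⟨i, hi⟩ := hne
  obtain ⟨a, b, hab, hlt⟩ := exists_adj_add_neg G hconn hG (s := s) (i := i)
    (by simp [s, hi, hdisj i hi]) hs
  -- Weights in `ℝ≥0` carry the iterates from `ℝ≥0∞` to `ℝ`.
  set q : V → ℝ≥0 := fun v => (μ {v}).toNNReal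
  have hq (v : V) : (q v : ℝ≥0∞) = μ {v} := ENNReal.coe_toNNReal (measure_ne_top _ _)
  have hreal (t : Set V) : (μ t).toReal = ∑ v, (q v : ℝ) * if v ∈ t then 1 else 0 := by
    rw [measure_eq_sum, ENNReal.toReal_sum fun v _ => by split_ifs <;> simp]
    refine Finset.sum_congr rfl fun v _ => ?_
    split_ifs <;> simp [q, ENNReal.coe_toNNReal_eq_toReal]
  have hcoe : (fun v => μ {v}) = ENNReal.ofNNRealHom ∘ q := funext fun v => (hq v).symm
  rw [hcoe] at hfin
  simp_rw [← map_iterate_tabooOp] at hfin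
  have hsum := NNReal.summable_coe.2 (ENNReal.tsum_coe_ne_top_iff_summable.1 hfin.ne)
  have hsum' : Summable fun n =>
      (tabooOp G (NNReal.toRealHom ∘ q) (emptyQueue G))^[n] 1 (emptyQueue G) := by
    simp_rw [← map_iterate_tabooOp]
    exact hsum
  refine not_summable_iterate_tabooOp G (s := s) (fun v => ?_) ?_ hs1 hs ?_ hab hlt hsum'
  · exact NNReal.coe_pos.2 (ENNReal.toNNReal_pos (hμ v).ne' (measure_ne_top _ _))
  · simpa using (hreal Set.univ).symm
  · have := ENNReal.toReal_mono (measure_ne_top μ I) hle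
    rw [hreal, hreal] at this
    simp only [s, mul_sub, Finset.sum_sub_distrib]
    exact sub_nonneg.2 this

end

/-! ### Uniqueness and existence of the stationary probability -/

section

variable {V : Type*} (G : SimpleGraph V) [DecidableRel G.Adj] [MeasurableSpace V] (μ : Measure V)

/-- Irreducibility: any word is emptied by letting a neighbour of its first letter arrive, again
and again, and is built from the empty word by the arrivals of its letters. -/
theorem ne_zero_of_stationary (hdeg : ∀ v, ∃ u, G.Adj v u) (hμ : ∀ v, 0 < μ {v})
    {ν : QueueDetail G → ℝ≥0∞} (hν : ∀ y, ν y = ∑' x, ν x * μ {v | fcfm G x v = y})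
    {x : QueueDetail G} (hx : ν x ≠ 0) (y : QueueDetail G) : ν y ≠ 0 := by
  have hstep (x : QueueDetail G) (hx : ν x ≠ 0) (v : V) : ν (fcfm G x v) ≠ 0 := by
    rw [hν]
    refine fun h => mul_ne_zero hx ?_ (ENNReal.tsum_eq_zero.1 h x)
    exact ((hμ v).trans_le (measure_mono (Set.singleton_subset_iff.2
      (Set.mem_ofPred_eq ▸ rfl)))).ne'
  have hempty : ν (emptyQueue G) ≠ 0 := by
    obtain ⟨l, hl⟩ := x
    induction l with
    | nil => exact hx
    | cons a l ih =>
      obtain ⟨v, hav⟩ := hdeg a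
      have heq : fcfm G ⟨a :: l, hl⟩ v =
          ⟨l, fun i hi j hj => hl i (by simp [hi]) j (by simp [hj])⟩ :=
        Subtype.ext (fcfmWord_of_match G (x₁ := []) (by simp) hav.symm)
      exact ih _ (heq ▸ hstep _ hx v)
  obtain ⟨l, hl⟩ := y
  induction l using List.reverseRecOn with
  | nil => exact hempty
  | append_singleton l v ih =>
    have heq : fcfm G ⟨l, fun i hi j hj => hl i (by simp [hi]) j (by simp [hj])⟩ v =
        ⟨l ++ [v], hl⟩ :=
      Subtype.ext (fcfmWord_of_forall_not_adj G fun u hu => hl v (by simp) u (by simp [hu]))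
    exact heq ▸ hstep _ (ih _) v

variable [Fintype V] [MeasurableSingletonClass V]

theorem tsum_tsum_mul_step [IsProbabilityMeasure μ] (f : QueueDetail G → ℝ≥0∞) :
    ∑' y, ∑' x, f x * μ {v | fcfm G x v = y} = ∑' x, f x := by
  classical
  rw [ENNReal.tsum_comm]
  refine tsum_congr fun x => ?_
  rw [ENNReal.tsum_mul_left]
  simp_rw [measure_eq_sum μ {v | fcfm G x v = _}]
  rw [Summable.tsum_finsetSum fun _ _ => ENNReal.summable]
  have h := measure_eq_sum μ Set.univ
  simp only [measure_univ, Set.mem_univ, if_true] at h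
  simp [← h]

theorem stationary_unique [IsProbabilityMeasure μ] (hdeg : ∀ v, ∃ u, G.Adj v u)
    (hμ : ∀ v, 0 < μ {v}) {π π' : PMF (QueueDetail G)} (hπ : IsStationary G μ π)
    (hπ' : IsStationary G μ π') : π' = π := by
  have htsum (f g : QueueDetail G → ℝ≥0∞) (hfg : f ≤ g) (hf : ∑' x, f x ≠ ∞)
      (h : ∑' x, f x = ∑' x, g x) (y : QueueDetail G) : f y = g y := by
    by_contra hne
    exact (ENNReal.tsum_lt_tsum hf hfg (lt_of_le_of_ne (hfg y) hne)).ne h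
  -- The minimum does not grow under a step, and its total mass is kept, so it is stationary.
  set m : QueueDetail G → ℝ≥0∞ := fun x => min (π x) (π' x)
  have hm : ∑' x, m x ≠ ∞ :=
    ne_top_of_le_ne_top (π.tsum_coe ▸ ENNReal.one_ne_top)
      (ENNReal.tsum_le_tsum fun x => min_le_left _ _)
  have hmstat (y : QueueDetail G) : ∑' x, m x * μ {v | fcfm G x v = y} = m y := by
    refine htsum (fun y => ∑' x, m x * μ {v | fcfm G x v = y}) m (fun y => le_min ?_ ?_)
      ?_ (tsum_tsum_mul_step G μ m) y
    · rw [hπ y]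
      exact ENNReal.tsum_le_tsum fun x => mul_le_mul_left (min_le_left _ _) _
    · rw [hπ' y]
      exact ENNReal.tsum_le_tsum fun x => mul_le_mul_left (min_le_right _ _) _
    · rwa [tsum_tsum_mul_step]
  have hmy (y : QueueDetail G) : m y ≠ ∞ :=
    ne_top_of_le_ne_top (π.apply_ne_top y) (min_le_left _ _)
  have hdiff (y : QueueDetail G) :
      π y - m y = ∑' x, (π x - m x) * μ {v | fcfm G x v = y} := by
    refine (ENNReal.eq_sub_of_add_eq (hmy y) ?_).symm
    rw [← hmstat y, ← ENNReal.tsum_add, hπ y]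
    refine tsum_congr fun x => ?_
    rw [← add_mul, tsub_add_cancel_of_le (min_le_left _ _)]
  have hle (y : QueueDetail G) : π y ≤ π' y := by
    by_contra! hlt
    have hy : π y - m y ≠ 0 := (tsub_pos_of_lt (min_lt_of_right_lt hlt)).ne'
    have hall (x : QueueDetail G) : π' x < π x := by
      have := ne_zero_of_stationary G μ hdeg hμ (ν := fun y => π y - m y) hdiff hy x
      have hlt := tsub_pos_iff_lt.1 (pos_iff_ne_zero.2 this)
      exact (min_lt_iff.1 hlt).resolve_left (lt_irrefl _)
    have := ENNReal.tsum_lt_tsum π'.tsum_coe_ne_top (fun x => (hall x).le) (hall y)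
    rw [π.tsum_coe, π'.tsum_coe] at this
    exact lt_irrefl _ this
  exact PMF.ext fun y => (htsum π π' hle π.tsum_coe_ne_top (by simp [PMF.tsum_coe]) y).symm

theorem exists_stationary [IsProbabilityMeasure μ] (hdeg : ∀ v, ∃ u, G.Adj v u)
    (hμ : ∀ v, 0 < μ {v}) (hN : NCond G μ) :
    ∃ π : PMF (QueueDetail G), (∀ w, π w = alpha G μ * productForm G μ w.1) ∧
      IsStationary G μ π := by
  have hsum : ∑' w : QueueDetail G, alpha G μ * productForm G μ w.1 = 1 := by
    rw [ENNReal.tsum_mul_left, ← tsum_admB_eq G μ hdeg, alpha]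
    refine ENNReal.inv_mul_cancel ?_ (tsum_PiB_admB_lt_top G μ hdeg hN).ne
    rw [tsum_admB_eq G μ hdeg]
    intro h
    simpa [emptyQueue] using ENNReal.tsum_eq_zero.1 h (emptyQueue G)
  refine ⟨⟨fun w => alpha G μ * productForm G μ w.1, hsum ▸ ENNReal.summable.hasSum⟩,
    fun w => rfl, fun y => ?_⟩
  change alpha G μ * productForm G μ y.1 =
    ∑' w : QueueDetail G, alpha G μ * productForm G μ w.1 * μ {v | fcfm G w v = y}
  simp_rw [mul_assoc]
  rw [ENNReal.tsum_mul_left, tsum_productForm_mul G μ hdeg hμ]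

end

end Matching

theorem theorem1 {V : Type*} [Finite V] [MeasurableSpace V] [MeasurableSingletonClass V]
    (G : SimpleGraph V) [DecidableRel G.Adj] (hconn : G.Connected) (hG : ¬ G.IsBipartite)
    (μ : Measure V) [IsProbabilityMeasure μ] (hμ : ∀ v, 0 < μ {v})
    {Ω : Type*} [MeasurableSpace Ω] (P : Measure Ω) [IsProbabilityMeasure P]
    (A : ℕ → Ω → V) (hA : ∀ n, Measurable (A n)) (hlaw : ∀ n, P.map (A n) = μ)
    (hindep : iIndepFun A P) :
    (Matching.IsStable G P A ↔ Matching.NCond G μ) ∧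
    (Matching.NCond G μ →
      ∃ π : PMF (Matching.QueueDetail G),
        (∀ w, π w = Matching.alpha G μ * Matching.productForm G μ w.1) ∧
        Matching.IsStationary G μ π ∧
        ∀ π' : PMF (Matching.QueueDetail G), Matching.IsStationary G μ π' → π' = π) := by
  have := Fintype.ofFinite V
  have hdeg := Matching.exists_adj_of_not_isBipartite G hconn hG
  refine ⟨⟨fun hstab => ?_, fun hN w => ?_⟩, fun hN => ?_⟩
  · have h := hstab (Matching.emptyQueue G)
    rw [Matching.lintegral_returnTime G hA hlaw hindep] at h
    exact Matching.nCond_of_tsum_lt_top G μ hconn hG hμ h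
  · obtain ⟨π, -, hstat⟩ := Matching.exists_stationary G μ hdeg hμ hN
    obtain ⟨x, hx⟩ := π.support_nonempty
    have hw : π w ≠ 0 := Matching.ne_zero_of_stationary G μ hdeg hμ hstat hx w
    rw [Matching.lintegral_returnTime G hA hlaw hindep]
    refine lt_top_iff_ne_top.2 fun htop => ?_
    have hle := Matching.mul_tsum_iterate_tabooOp_le G μ hstat π.tsum_coe w
    rw [htop, ENNReal.mul_top hw] at hle
    exact absurd hle (by simp)
  · obtain ⟨π, hform, hstat⟩ := Matching.exists_stationary G μ hdeg hμ hN
    exact ⟨π, hform, hstat, fun π' hπ' => Matching.stationary_unique G μ hdeg hμ hstat hπ'⟩
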